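/- **Setting.** Let $a<t_0<t_1<b$, $I=[t_0,t_1]$, $x_0,x_1\in\mathbb R^n$, and let $L=L(t,x,y):(a,b)\times\mathbb R^n\times\mathbb R^n\to\mathbb R$. Write $L_x,L_{xx}$ for the derivatives in $x$ and $L_{\dot x}$ for the derivative in $y$. A function $x:I\to\mathbb R^n$ is *admissible* if it is piecewise smooth (continuous on $I$, with $\dot x$ existing and continuous on $I$ except at finitely many interior points, where $\dot x$ has finite one-sided limits; $\dot x$ also has finite one-sided limits at $t_0$ and $t_1$) and $x(t_0)=x_0$, $x(t_1)=x_1$. An admissible $\bar x$ is a *strong local minimum* of $J(x)=\int_{t_0}^{t_1}L(t,x(t),\dot x(t))\,dt$ if there is $\delta>0$ with $J(x)\ge J(\bar x)$ for all admissible $x$ with $\max_{t\in I}\|x(t)-\bar x(t)\|\le\delta$. For $\xi\in\mathbb R^n$ and $\lambda\in(0,1)$ put, along $\bar x$, $$E(\bar L)(t,\xi)=L(t,\bar x,\dot{\bar x}+\xi)-L(t,\bar x,\dot{\bar x})-L_{\dot x}(t,\bar x,\dot{\bar x})^T\xi,$$ $$\Delta\bar L_x(t,\xi)=L_x(t,\bar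 x,\dot{\bar x}+\xi)-L_x(t,\bar x,\dot{\bar x}),\qquad \bar L_{xx}(t,\xi)=L_{xx}(t,\bar x,\dot{\bar x}+\xi),$$ $$Q_i(t,\lambda,\xi)=\lambda^iE(\bar L)(t,\xi)+(1-\lambda^i)E(\bar L)\big(t,\tfrac{\lambda}{\lambda-1}\xi\big),$$ $$M_i(t,\lambda,\xi)=\lambda^i\Delta\bar L_x(t,\xi)^T\xi+(1-\lambda)\big(\tfrac12+\lambda\big)^{i-1}\Delta\bar L_x\big(t,\tfrac{\lambda}{\lambda-1}\xi\big)^T\xi,$$ $$W(\bar L)(t,\lambda,\xi)=\lambda M_1(t,\lambda,\xi)+\tfrac{d}{dt}Q_2(t,\lambda,\xi),$$ $$G(\bar L)(t,\lambda,\xi)=\lambda^2\xi^T\Big[\lambda\bar L_{xx}(t,\xi)+(1-\lambda)\bar L_{xx}\big(t,\tfrac{\lambda}{\lambda-1}\xi\big)\Big]\xi+2\lambda\tfrac{d}{dt}M_2(t,\lambda,\xi)+\tfrac{d^2}{dt^2}Q_3(t,\lambda,\xi),$$ where $\bar x,\dot{\bar x}$ are taken at $t$. An argument $\theta+$ (respectively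 $\theta-$) means that all time derivatives at $\theta$, including $\dot{\bar x}(\theta)$, are right (respectively left) derivatives. **Theorem 3.2.** Let $L$ and $L_{\dot x}$ be twice continuously differentiable on $(a,b)\times\mathbb R^n\times\mathbb R^n$ in all variables jointly, and let $\bar x$ be a strong local minimum. Let $\bar\lambda\in(0,1)$ and $\eta\in\mathbb R^n\setminus\{0\}$. (i) Let $\theta\in[t_0,t_1)$ (respectively $\theta\in(t_0,t_1]$), and let $\bar x$ be three times differentiable on some $[\theta,\theta+\alpha)\subset I$ (respectively $(\theta-\alpha,\theta]\subset I$), $\alpha>0$, with one-sided derivatives at $\theta$. If $$E(\bar L)(\theta\pm,\eta)=E(\bar L)\big(\theta\pm,\tfrac{\bar\lambda}{\bar\lambda-1}\eta\big)=0\quad\text{and}\quad W(\bar L)(\theta\pm,\bar\lambda,\eta)=0,$$ then $G(\bar L)(\theta\pm,\bar\lambda,\eta)\ge0$, with the sign $+$ (respectively $-$) throughout. (ii) Let $\theta\in(t_0,t_1)$ and let $\bar x$ be three times differentiable at $\theta$. If $$E(\bar L)(\theta,\eta)=E(\bar L)\big(\theta,\tfrac{\bar\lambda}{\bar\lambda-1}\eta\big)=0,$$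 then $G(\bar L)(\theta,\bar\lambda,\eta)\ge0$. -/

import Mathlib

open Set Filter Topology

namespace CalcVar

variable {E : Type*} [NormedAddCommGroup E] [NormedSpace ℝ E]

/-- Piecewise smooth functions `KC¹(I, E)`, `I = [t₀, t₁]`: continuous on `I`, with a derivative that
exists and is continuous away from finitely many interior points, and that has finite one-sided
limits everywhere (from the right at `t₀`, from the left at `t₁`, from both sides in between).
Only the values of `x` on `I` matter. -/
def PiecewiseSmooth (t₀ t₁ : ℝ) (x : ℝ → E) : Prop :=
  ContinuousOn x (Icc t₀ t₁) ∧
  (∃ τ : Finset ℝ, (τ : Set ℝ) ⊆ Ioo t₀ t₁ ∧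
    (∀ t ∈ Ioo t₀ t₁ \ (τ : Set ℝ), DifferentiableAt ℝ x t) ∧
    ContinuousOn (deriv x) (Ioo t₀ t₁ \ (τ : Set ℝ))) ∧
  (∀ t ∈ Ico t₀ t₁, ∃ v : E, Tendsto (deriv x) (𝓝[>] t) (𝓝 v)) ∧
  (∀ t ∈ Ioc t₀ t₁, ∃ v : E, Tendsto (deriv x) (𝓝[<] t) (𝓝 v))

/-- Admissible functions: piecewise smooth functions with the prescribed boundary values. -/
def Admissible (t₀ t₁ : ℝ) (x₀ x₁ : E) (x : ℝ → E) : Prop :=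
  PiecewiseSmooth t₀ t₁ x ∧ x t₀ = x₀ ∧ x t₁ = x₁

/-- The functional `J(x) = ∫ L(t, x(t), ẋ(t)) dt` over `[t₀, t₁]`. -/
noncomputable def functional (t₀ t₁ : ℝ) (L : ℝ → E → E → ℝ) (x : ℝ → E) : ℝ :=
  ∫ t in t₀..t₁, L t (x t) (deriv x t)

/-- `xbar` is a strong local minimum: it is admissible and it minimizes `J` among the admissible
functions in a neighbourhood of it in the uniform norm of `C([t₀, t₁], E)`. -/
def IsStrongLocalMin (t₀ t₁ : ℝ) (x₀ x₁ : E) (L : ℝ → E → E → ℝ) (xbar : ℝ → E) : Prop :=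
  Admissible t₀ t₁ x₀ x₁ xbar ∧
  ∃ δ > 0, ∀ x : ℝ → E, Admissible t₀ t₁ x₀ x₁ x →
    (∀ t ∈ Icc t₀ t₁, ‖x t - xbar t‖ ≤ δ) →
    functional t₀ t₁ L xbar ≤ functional t₀ t₁ L x

/-- The partial derivative `L_x(t, x, y)`, as the linear form `ξ ↦ L_xᵀ ξ`. -/
noncomputable def Lx (L : ℝ → E → E → ℝ) (t : ℝ) (x y : E) : E →L[ℝ] ℝ :=
  fderiv ℝ (fun z => L t z y) x

/-- The partial derivative `L_ẋ(t, x, y)` in the last variable, as a linear form. -/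
noncomputable def Lv (L : ℝ → E → E → ℝ) (t : ℝ) (x y : E) : E →L[ℝ] ℝ :=
  fderiv ℝ (fun z => L t x z) y

/-- The second partial derivative `L_xx(t, x, y)`, as a bilinear form. -/
noncomputable def Lxx (L : ℝ → E → E → ℝ) (t : ℝ) (x y : E) : E →L[ℝ] E →L[ℝ] ℝ :=
  fderiv ℝ (fun z => Lx L t z y) x

/-- The Weierstrass function `E(L)(t, x, y, z)`. -/
noncomputable def weierstrassFun (L : ℝ → E → E → ℝ) (t : ℝ) (x y z : E) : ℝ :=
  L t x z - L t x y - Lv L t x y (z - y)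

/-! The quantities along a function `x`. All time derivatives are taken within the set `s`:
`s = Ici θ` gives the values at `θ+` (right derivatives at `θ`, ordinary derivatives at later times),
`s = Iic θ` gives the values at `θ-`, and `s = univ` gives the ordinary two-sided quantities. -/

/-- `E(L̄)(t, ξ)`. -/
noncomputable def EBar (L : ℝ → E → E → ℝ) (x : ℝ → E) (s : Set ℝ) (t : ℝ) (ξ : E) : ℝ :=
  weierstrassFun L t (x t) (derivWithin x s t) (derivWithin x s t + ξ)

/-- `ΔL̄_x(t, ξ) = L_x(t, x(t), ẋ(t) + ξ) - L_x(t, x(t), ẋ(t))`. -/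
noncomputable def DeltaLx (L : ℝ → E → E → ℝ) (x : ℝ → E) (s : Set ℝ) (t : ℝ) (ξ : E) :
    E →L[ℝ] ℝ :=
  Lx L t (x t) (derivWithin x s t + ξ) - Lx L t (x t) (derivWithin x s t)

/-- `L̄_xx(t, ξ) = L_xx(t, x(t), ẋ(t) + ξ)`. -/
noncomputable def LxxBar (L : ℝ → E → E → ℝ) (x : ℝ → E) (s : Set ℝ) (t : ℝ) (ξ : E) :
    E →L[ℝ] E →L[ℝ] ℝ :=
  Lxx L t (x t) (derivWithin x s t + ξ)

/-- `Q_i(L̄)(t, l, ξ)`, used for `i = 2, 3`. -/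
noncomputable def Q (i : ℕ) (L : ℝ → E → E → ℝ) (x : ℝ → E) (s : Set ℝ) (t l : ℝ) (ξ : E) : ℝ :=
  l ^ i * EBar L x s t ξ + (1 - l ^ i) * EBar L x s t ((l / (l - 1)) • ξ)

/-- `M_i(L̄_x)(t, l, ξ)`, used for `i = 1, 2`. -/
noncomputable def M (i : ℕ) (L : ℝ → E → E → ℝ) (x : ℝ → E) (s : Set ℝ) (t l : ℝ) (ξ : E) : ℝ :=
  l ^ i * DeltaLx L x s t ξ ξ
    + (1 - l) * (1 / 2 + l) ^ (i - 1) * DeltaLx L x s t ((l / (l - 1)) • ξ) ξ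

/-- `W(L̄)(θ, l, ξ) = l M₁ + (d/dt) Q₂`. -/
noncomputable def W (L : ℝ → E → E → ℝ) (x : ℝ → E) (s : Set ℝ) (θ l : ℝ) (ξ : E) : ℝ :=
  l * M 1 L x s θ l ξ + derivWithin (fun t => Q 2 L x s t l ξ) s θ

/-- `G(L̄)(θ, l, ξ) = l² ξᵀ [l L̄_xx(θ, ξ) + (1 - l) L̄_xx(θ, l ξ / (l - 1))] ξ
+ 2 l (d/dt) M₂ + (d²/dt²) Q₃`. -/
noncomputable def G (L : ℝ → E → E → ℝ) (x : ℝ → E) (s : Set ℝ) (θ l : ℝ) (ξ : E) : ℝ :=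
  l ^ 2 * (l * LxxBar L x s θ ξ ξ ξ + (1 - l) * LxxBar L x s θ ((l / (l - 1)) • ξ) ξ ξ)
    + 2 * l * derivWithin (fun t => M 2 L x s t l ξ) s θ
    + derivWithin (derivWithin (fun t => Q 3 L x s t l ξ) s) s θ

/-- `x` is three times differentiable at every point of the interval `s` (one-sidedly at an
endpoint that belongs to `s`). -/
def ThriceDifferentiableOn (x : ℝ → E) (s : Set ℝ) : Prop :=
  DifferentiableOn ℝ x s ∧ DifferentiableOn ℝ (derivWithin x s) s ∧
    DifferentiableOn ℝ (derivWithin (derivWithin x s) s) s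

/-- `x` is three times differentiable at the point `θ`: it is twice differentiable near `θ` and its
second derivative is differentiable at `θ`. -/
def ThriceDifferentiableAt (x : ℝ → E) (θ : ℝ) : Prop :=
  (∀ᶠ t in 𝓝 θ, DifferentiableAt ℝ x t) ∧ (∀ᶠ t in 𝓝 θ, DifferentiableAt ℝ (deriv x) t) ∧
    DifferentiableAt ℝ (deriv (deriv x)) θ

end CalcVar

/-! The comparison function is a tent: near `θ` add to `x̄` a continuous function that vanishes
outside an interval of length `ε` ending at `θ`, with slope `ξ` on the part of length `lε` adjacent
to `θ` and slope `cξ`, `c = l / (l - 1)`, on the rest. The choice of `c` closes the tent. It is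
uniformly of size `O(ε)`, so it competes with a strong minimum although its slopes do not shrink.

Scaling the same tent by `|k| ≤ 1` also gives competitors, so `k = 0` minimizes a differentiable
function and the first variation along the tent is zero. Hence the linear part of the increment can
be subtracted without changing its sign (`integral_excess_nonneg`); no Euler equation is needed. At
slope `ζ` and value `ωζ`, what remains of the integrand is `E(L̄)(t, ζ) + ω ΔL̄_x(t, ζ)ζ + (ω²/2)
L̄_xx(t, ζ)ζζ` up to second order (`abs_excess_sub_le`), where `ω` is the distance to the foot of
the tent, with sign.

If both values of `E(L̄)` at `θ` vanish, expanding in time and integrating over the two pieces gives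
`F(ε) = (ε²/2) W + (ε³/6) G + o(ε³)` (`abs_tentExcess_sub_le`). On the right `F(ε) ≥ 0`, so `W ≥ 0`,
and `W = 0` forces `G ≥ 0`. On the left the oriented integrals give `-F(-ε) ≥ 0`: the sign of `W` is
reversed while that of `G` is kept. At a point of two-sided smoothness both apply, so `W = 0` comes
for free. -/

namespace CalcVar

/-! ### One-sided Taylor expansions -/

section Taylor

variable {F : Type*} [NormedAddCommGroup F] [NormedSpace ℝ F]

/-- `g` is differentiable within `s` near `θ`, and its derivative is differentiable within `s`
at `θ`. -/
def TwiceDiffWithinAt (g : ℝ → F) (s : Set ℝ) (θ : ℝ) : Prop :=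
  (∀ᶠ t in 𝓝[s] θ, DifferentiableWithinAt ℝ g s t) ∧
    DifferentiableWithinAt ℝ (derivWithin g s) s θ

theorem derivWithin_eventuallyEq {g g' : ℝ → F} {s : Set ℝ} {θ : ℝ} (hs : UniqueDiffOn ℝ s)
    (h : ∀ᶠ t in 𝓝[s] θ, HasDerivWithinAt g (g' t) s t) :
    derivWithin g s =ᶠ[𝓝[s] θ] g' := by
  filter_upwards [h, self_mem_nhdsWithin] with t ht hts
  exact ht.derivWithin (hs t hts)

theorem twiceDiffWithinAt_of_hasDerivWithinAt {g g' : ℝ → F} {s : Set ℝ} {θ : ℝ}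
    (hs : UniqueDiffOn ℝ s) (hθ : θ ∈ s) (h : ∀ᶠ t in 𝓝[s] θ, HasDerivWithinAt g (g' t) s t)
    (h' : DifferentiableWithinAt ℝ g' s θ) : TwiceDiffWithinAt g s θ := by
  have he := derivWithin_eventuallyEq hs h
  exact ⟨h.mono fun t ht => ht.differentiableWithinAt,
    h'.congr_of_eventuallyEq he (he.self_of_nhdsWithin hθ)⟩

theorem TwiceDiffWithinAt.hasDerivWithinAt {g : ℝ → F} {s : Set ℝ} {θ : ℝ}
    (h : TwiceDiffWithinAt g s θ) :
    ∀ᶠ t in 𝓝[s] θ, HasDerivWithinAt g (derivWithin g s t) s t :=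
  h.1.mono fun _ ht => ht.hasDerivWithinAt

theorem TwiceDiffWithinAt.differentiableWithinAt {g : ℝ → F} {s : Set ℝ} {θ : ℝ}
    (h : TwiceDiffWithinAt g s θ) (hθ : θ ∈ s) : DifferentiableWithinAt ℝ g s θ :=
  h.1.self_of_nhdsWithin hθ

theorem DifferentiableWithinAt.exists_bound {g : ℝ → F} {s : Set ℝ} {θ : ℝ}
    (h : DifferentiableWithinAt ℝ g s θ) {κ : ℝ} (hκ : 0 < κ) :
    ∃ r > 0, ∀ t ∈ s, |t - θ| < r →
      ‖g t - g θ - (t - θ) • derivWithin g s θ‖ ≤ κ * |t - θ| := by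
  have := (hasDerivWithinAt_iff_isLittleO.1 h.hasDerivWithinAt).def hκ
  obtain ⟨r, hr, H⟩ := Metric.mem_nhdsWithin_iff.1 this
  exact ⟨r, hr, fun t ht htr => H ⟨by simpa [Real.dist_eq] using htr, ht⟩⟩

/-- Second order Taylor expansion with the remainder in Peano's form. -/
theorem TwiceDiffWithinAt.exists_bound {g : ℝ → ℝ} {s : Set ℝ} {θ : ℝ}
    (h : TwiceDiffWithinAt g s θ) (hs : Convex ℝ s) (hθ : θ ∈ s) {κ : ℝ} (hκ : 0 < κ) :
    ∃ r > 0, ∀ t ∈ s, |t - θ| < r →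
      |g t - g θ - derivWithin g s θ * (t - θ)
        - derivWithin (derivWithin g s) s θ / 2 * (t - θ) ^ 2| ≤ κ * (t - θ) ^ 2 := by
  obtain ⟨r₁, hr₁, H₁⟩ := DifferentiableWithinAt.exists_bound h.2 hκ
  obtain ⟨r₂, hr₂, H₂⟩ := Metric.mem_nhdsWithin_iff.1 h.hasDerivWithinAt
  refine ⟨min r₁ r₂, lt_min hr₁ hr₂, fun t ht htr => ?_⟩
  -- Mean value inequality for the remainder on the part of `s` within `|t - θ|` of `θ`: there its
  -- derivative is at most `κ |t - θ|`, by differentiability of the first derivative at the single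
  -- point `θ`.
  have key := Convex.norm_image_sub_le_of_norm_hasDerivWithin_le (𝕜 := ℝ)
    (f := fun τ => g τ - g θ - derivWithin g s θ * (τ - θ)
        - derivWithin (derivWithin g s) s θ / 2 * (τ - θ) ^ 2)
    (f' := fun τ => derivWithin g s τ - derivWithin g s θ
        - (τ - θ) * derivWithin (derivWithin g s) s θ)
    (s := s ∩ Metric.closedBall θ |t - θ|) (x := θ) (y := t) (C := κ * |t - θ|)
    (fun τ hτ => by
      have hτ' : |τ - θ| ≤ |t - θ| := by simpa [Real.dist_eq] using hτ.2
      have h1 : HasDerivWithinAt g (derivWithin g s τ) s τ :=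
        H₂ ⟨by rw [Metric.mem_ball, Real.dist_eq]
               exact hτ'.trans_lt (htr.trans_le (min_le_right _ _)), hτ.1⟩
      have h2 : HasDerivWithinAt (fun τ : ℝ => τ - θ) 1 s τ := (hasDerivWithinAt_id τ s).sub_const θ
      refine HasDerivWithinAt.mono ?_ inter_subset_left
      refine (((h1.sub_const (g θ)).sub (h2.const_mul (derivWithin g s θ))).sub
        ((h2.pow 2).const_mul (derivWithin (derivWithin g s) s θ / 2))).congr_deriv ?_
      push_cast
      ring)
    (fun τ hτ => by
      have hτ' : |τ - θ| ≤ |t - θ| := by simpa [Real.dist_eq] using hτ.2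
      refine (H₁ τ hτ.1 (hτ'.trans_lt (htr.trans_le (min_le_left _ _)))).trans ?_
      gcongr)
    (hs.inter (convex_closedBall _ _)) ⟨hθ, by simp⟩ ⟨ht, by simp [Real.dist_eq]⟩
  simpa [mul_assoc, ← sq] using key

/-- Second order Taylor expansion of a `C¹`-function on the line whose derivative is almost
linear. -/
theorem abs_sub_taylor_le {g g' g'' : ℝ → ℝ} {B κ ω : ℝ}
    (hg : ∀ τ, HasDerivAt g (g' τ) τ) (hg' : ∀ τ, HasDerivAt g' (g'' τ) τ)
    (hB : ∀ τ, |τ| ≤ |ω| → |g'' τ - B| ≤ κ) :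
    |g ω - g 0 - g' 0 * ω - B / 2 * ω ^ 2| ≤ κ * ω ^ 2 := by
  have first : ∀ τ, |τ| ≤ |ω| → |g' τ - g' 0 - B * τ| ≤ κ * |τ| := fun τ hτ => by
    have key := Convex.norm_image_sub_le_of_norm_hasDerivWithin_le (𝕜 := ℝ)
      (f := fun τ => g' τ - g' 0 - B * τ) (f' := fun τ => g'' τ - B)
      (s := Metric.closedBall 0 |ω|) (x := 0) (y := τ) (C := κ)
      (fun τ _ => by
        refine HasDerivAt.hasDerivWithinAt ?_
        exact (((hg' τ).sub_const (g' 0)).sub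
          ((hasDerivAt_id τ).const_mul B)).congr_deriv (by ring))
      (fun τ hτ => hB τ (by simpa using hτ))
      (convex_closedBall _ _) (by simp) (by simpa using hτ)
    simpa using key
  have hκ : 0 ≤ κ := (abs_nonneg _).trans (hB 0 (by simp))
  have key := Convex.norm_image_sub_le_of_norm_hasDerivWithin_le (𝕜 := ℝ)
    (f := fun τ => g τ - g 0 - g' 0 * τ - B / 2 * τ ^ 2) (f' := fun τ => g' τ - g' 0 - B * τ)
    (s := Metric.closedBall 0 |ω|) (x := 0) (y := ω) (C := κ * |ω|)
    (fun τ _ => by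
      refine HasDerivAt.hasDerivWithinAt ?_
      refine ((((hg τ).sub_const (g 0)).sub ((hasDerivAt_id τ).const_mul (g' 0))).sub
        (((hasDerivAt_id τ).pow 2).const_mul (B / 2))).congr_deriv ?_
      simp only [id]
      push_cast
      ring)
    (fun τ hτ => by
      have hτ' : |τ| ≤ |ω| := by simpa using hτ
      refine (first τ hτ').trans ?_
      gcongr)
    (convex_closedBall _ _) (by simp) (by simp)
  simpa [mul_assoc, ← sq] using key

/-- The first derivative `Df(γ)γ'` exists near `θ`. At `θ` it is differentiable, since `Df` is `C¹`
and `γ'` is differentiable there. -/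
theorem TwiceDiffWithinAt.comp {P : Type*} [NormedAddCommGroup P] [NormedSpace ℝ P]
    {f : P → F} {U : Set P} (hU : IsOpen U) (hf : ContDiffOn ℝ 2 f U) {γ : ℝ → P} {s : Set ℝ}
    {θ : ℝ} (hs : UniqueDiffOn ℝ s) (hθ : θ ∈ s) (hγ : TwiceDiffWithinAt γ s θ) (hγU : γ θ ∈ U) :
    TwiceDiffWithinAt (fun t => f (γ t)) s θ := by
  have hc : ∀ᶠ t in 𝓝[s] θ, γ t ∈ U :=
    (hγ.differentiableWithinAt hθ).continuousWithinAt.eventually_mem (hU.mem_nhds hγU)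
  refine twiceDiffWithinAt_of_hasDerivWithinAt hs hθ
    (g' := fun t => fderiv ℝ f (γ t) (derivWithin γ s t)) ?_ ?_
  · filter_upwards [hc, hγ.hasDerivWithinAt] with t ht hd
    exact (((hf.differentiableOn (by norm_num)).differentiableAt
      (hU.mem_nhds ht)).hasFDerivAt.comp_hasDerivWithinAt t hd)
  · have h1 : ContDiffOn ℝ 1 (fderiv ℝ f) U := hf.fderiv_of_isOpen hU (by norm_num)
    have h2 : DifferentiableAt ℝ (fderiv ℝ f) (γ θ) :=
      (h1.differentiableOn (by norm_num)).differentiableAt (hU.mem_nhds hγU)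
    exact (h2.comp_differentiableWithinAt θ (hγ.differentiableWithinAt hθ)).clm_apply hγ.2

theorem TwiceDiffWithinAt.sub {f g : ℝ → F} {s : Set ℝ} {θ : ℝ} (hs : UniqueDiffOn ℝ s)
    (hθ : θ ∈ s) (hf : TwiceDiffWithinAt f s θ) (hg : TwiceDiffWithinAt g s θ) :
    TwiceDiffWithinAt (fun t => f t - g t) s θ := by
  refine twiceDiffWithinAt_of_hasDerivWithinAt hs hθ ?_ (hf.2.sub hg.2)
  filter_upwards [hf.hasDerivWithinAt, hg.hasDerivWithinAt] with t h1 h2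
  exact h1.sub h2

/-- Serves to read off the time derivatives of `Q 2` and `Q 3` from those of the two values of
`E(L̄)`. -/
theorem TwiceDiffWithinAt.linear_combination {f g : ℝ → ℝ} {s : Set ℝ} {θ : ℝ}
    (hs : UniqueDiffOn ℝ s) (hθ : θ ∈ s) (hf : TwiceDiffWithinAt f s θ)
    (hg : TwiceDiffWithinAt g s θ) (c d : ℝ) :
    derivWithin (fun t => c * f t + d * g t) s θ
        = c * derivWithin f s θ + d * derivWithin g s θ ∧
      derivWithin (derivWithin (fun t => c * f t + d * g t) s) s θ
        = c * derivWithin (derivWithin f s) s θ + d * derivWithin (derivWithin g s) s θ := by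
  have h1 : ∀ᶠ t in 𝓝[s] θ, HasDerivWithinAt (fun t => c * f t + d * g t)
      (c * derivWithin f s t + d * derivWithin g s t) s t := by
    filter_upwards [hf.hasDerivWithinAt, hg.hasDerivWithinAt] with t h1 h2
    exact (h1.const_mul c).add (h2.const_mul d)
  have he := derivWithin_eventuallyEq hs h1
  refine ⟨he.self_of_nhdsWithin hθ, ?_⟩
  rw [he.derivWithin_eq (he.self_of_nhdsWithin hθ)]
  exact ((hf.2.hasDerivWithinAt.const_mul c).add
    (hg.2.hasDerivWithinAt.const_mul d)).derivWithin (hs θ hθ)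

end Taylor

/-! ### Regularity of the partial derivatives of the integrand -/

section Partial

variable {E : Type*} [NormedAddCommGroup E] [NormedSpace ℝ E]
  {F : Type*} [NormedAddCommGroup F] [NormedSpace ℝ F]

theorem hasFDerivAt_partial_x {f : ℝ × E × E → F} {f' : ℝ × E × E →L[ℝ] F} {t : ℝ} {x y : E}
    (hf : HasFDerivAt f f' (t, x, y)) :
    HasFDerivAt (fun z => f (t, z, y))
      (f'.comp ((ContinuousLinearMap.inr ℝ ℝ (E × E)).comp (ContinuousLinearMap.inl ℝ E E))) x :=
  hf.comp x ((hasFDerivAt_prodMk_right t (x, y)).comp x (hasFDerivAt_prodMk_left x y))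

theorem hasFDerivAt_partial_v {f : ℝ × E × E → F} {f' : ℝ × E × E →L[ℝ] F} {t : ℝ} {x y : E}
    (hf : HasFDerivAt f f' (t, x, y)) :
    HasFDerivAt (fun z => f (t, x, z))
      (f'.comp ((ContinuousLinearMap.inr ℝ ℝ (E × E)).comp (ContinuousLinearMap.inr ℝ E E))) y :=
  hf.comp y ((hasFDerivAt_prodMk_right t (x, y)).comp y (hasFDerivAt_prodMk_right x y))

/-- The partial derivative is the total derivative composed with a fixed inclusion, so exactly one
order of smoothness is lost. -/
theorem contDiffOn_partial_x {f : ℝ × E × E → F} {U : Set (ℝ × E × E)} (hU : IsOpen U)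
    {m n : WithTop ℕ∞} (hf : ContDiffOn ℝ n f U) (hmn : m + 1 ≤ n) :
    ContDiffOn ℝ m (fun p => fderiv ℝ (fun z => f (p.1, z, p.2.2)) p.2.1) U := by
  have hn : n ≠ 0 := by rintro rfl; simp at hmn
  refine ((hf.fderiv_of_isOpen hU hmn).clm_comp
    (contDiffOn_const (c := (ContinuousLinearMap.inr ℝ ℝ (E × E)).comp
      (ContinuousLinearMap.inl ℝ E E)))).congr ?_
  intro p hp
  exact (hasFDerivAt_partial_x
    (((hf.differentiableOn hn).differentiableAt (hU.mem_nhds hp)).hasFDerivAt)).fderiv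

variable {a b : ℝ} {L : ℝ → E → E → ℝ}

theorem isOpen_domain {E : Type*} [NormedAddCommGroup E] (a b : ℝ) :
    IsOpen (Ioo a b ×ˢ (univ : Set (E × E))) :=
  isOpen_Ioo.prod isOpen_univ

theorem contDiffOn_Lx
    (hL : ContDiffOn ℝ 2 (fun p : ℝ × E × E => L p.1 p.2.1 p.2.2) (Ioo a b ×ˢ univ)) :
    ContDiffOn ℝ 1 (fun p : ℝ × E × E => Lx L p.1 p.2.1 p.2.2) (Ioo a b ×ˢ univ) :=
  contDiffOn_partial_x (isOpen_domain a b) hL (by norm_num)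

theorem continuousOn_Lxx
    (hL : ContDiffOn ℝ 2 (fun p : ℝ × E × E => L p.1 p.2.1 p.2.2) (Ioo a b ×ˢ univ)) :
    ContinuousOn (fun p : ℝ × E × E => Lxx L p.1 p.2.1 p.2.2) (Ioo a b ×ˢ univ) :=
  (contDiffOn_partial_x (m := 0) (isOpen_domain a b) (contDiffOn_Lx hL) (by norm_num)).continuousOn

theorem differentiableAt_integrand
    (hL : ContDiffOn ℝ 2 (fun p : ℝ × E × E => L p.1 p.2.1 p.2.2) (Ioo a b ×ˢ univ))
    {t : ℝ} (ht : t ∈ Ioo a b) (x y : E) :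
    DifferentiableAt ℝ (fun p : ℝ × E × E => L p.1 p.2.1 p.2.2) (t, x, y) :=
  (hL.differentiableOn (by norm_num)).differentiableAt
    ((isOpen_domain a b).mem_nhds ⟨ht, trivial⟩)

theorem hasFDerivAt_Lx
    (hL : ContDiffOn ℝ 2 (fun p : ℝ × E × E => L p.1 p.2.1 p.2.2) (Ioo a b ×ˢ univ))
    {t : ℝ} (ht : t ∈ Ioo a b) (x y : E) : HasFDerivAt (fun z => L t z y) (Lx L t x y) x :=
  (hasFDerivAt_partial_x (differentiableAt_integrand hL ht x y).hasFDerivAt).differentiableAt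
    |>.hasFDerivAt

theorem hasFDerivAt_Lxx
    (hL : ContDiffOn ℝ 2 (fun p : ℝ × E × E => L p.1 p.2.1 p.2.2) (Ioo a b ×ˢ univ))
    {t : ℝ} (ht : t ∈ Ioo a b) (x y : E) : HasFDerivAt (fun z => Lx L t z y) (Lxx L t x y) x :=
  (hasFDerivAt_partial_x (f := fun p : ℝ × E × E => Lx L p.1 p.2.1 p.2.2)
    (((contDiffOn_Lx hL).differentiableOn (by norm_num)).differentiableAt
    ((isOpen_domain a b).mem_nhds ⟨ht, trivial⟩)).hasFDerivAt).differentiableAt.hasFDerivAt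

theorem fderiv_integrand_apply
    (hL : ContDiffOn ℝ 2 (fun p : ℝ × E × E => L p.1 p.2.1 p.2.2) (Ioo a b ×ˢ univ))
    {t : ℝ} (ht : t ∈ Ioo a b) (x y h u : E) :
    fderiv ℝ (fun p : ℝ × E × E => L p.1 p.2.1 p.2.2) (t, x, y) (0, h, u)
      = Lx L t x y h + Lv L t x y u := by
  have hd := (differentiableAt_integrand hL ht x y).hasFDerivAt
  have h1 := (hasFDerivAt_partial_x hd).fderiv
  have h2 := (hasFDerivAt_partial_v hd).fderiv
  simp only at h1 h2
  rw [Lx, Lv, h1, h2]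
  simp [← map_add]

end Partial

/-! ### Piecewise smooth functions, ramps, and integrability of the integrand -/

section Variation

variable {E : Type*} [NormedAddCommGroup E] [NormedSpace ℝ E]

theorem PiecewiseSmooth.add {t₀ t₁ : ℝ} {x y : ℝ → E} (hx : PiecewiseSmooth t₀ t₁ x)
    (hy : PiecewiseSmooth t₀ t₁ y) : PiecewiseSmooth t₀ t₁ (fun t => x t + y t) := by
  classical
  obtain ⟨hxc, ⟨τ, hτ, hxd, hxdc⟩, hxr, hxl⟩ := hx
  obtain ⟨hyc, ⟨σ, hσ, hyd, hydc⟩, hyr, hyl⟩ := hy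
  have hd : ∀ t ∈ Ioo t₀ t₁ \ ((τ ∪ σ : Finset ℝ) : Set ℝ),
      deriv (fun t => x t + y t) t = deriv x t + deriv y t := fun t ht => by
    simp only [Finset.coe_union, Set.mem_sdiff, mem_union, not_or] at ht
    exact deriv_fun_add (hxd t ⟨ht.1, ht.2.1⟩) (hyd t ⟨ht.1, ht.2.2⟩)
  -- A finite set is avoided on a punctured neighbourhood of any point, so the sum rule for `deriv`
  -- is available in both one-sided limits.
  have hfin : ∀ t, ∀ᶠ s in 𝓝[≠] t, s ∉ ((τ ∪ σ : Finset ℝ) : Set ℝ) := fun t => by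
    have h : (((τ ∪ σ : Finset ℝ) : Set ℝ) \ {t})ᶜ ∈ 𝓝 t :=
      ((τ ∪ σ).finite_toSet.subset sdiff_subset).isClosed.isOpen_compl.mem_nhds (by simp)
    filter_upwards [mem_nhdsWithin_of_mem_nhds h, self_mem_nhdsWithin] with s hs hs' hmem
    exact hs ⟨hmem, hs'⟩
  refine ⟨hxc.add hyc, ⟨τ ∪ σ, ?_, ?_, ?_⟩, ?_, ?_⟩
  · rw [Finset.coe_union]
    exact union_subset hτ hσ
  · intro t ht
    simp only [Finset.coe_union, Set.mem_sdiff, mem_union, not_or] at ht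
    exact (hxd t ⟨ht.1, ht.2.1⟩).add (hyd t ⟨ht.1, ht.2.2⟩)
  · refine ContinuousOn.congr ?_ hd
    refine (hxdc.mono ?_).add (hydc.mono ?_) <;>
    · rw [Finset.coe_union]
      gcongr
      simp
  · intro t ht
    obtain ⟨v, hv⟩ := hxr t ht
    obtain ⟨w, hw⟩ := hyr t ht
    refine ⟨v + w, (hv.add hw).congr' ?_⟩
    filter_upwards [Ioo_mem_nhdsGT ht.2, nhdsGT_le_nhdsNE t (hfin t)] with s hs hs'
    exact (hd s ⟨⟨ht.1.trans_lt hs.1, hs.2⟩, hs'⟩).symm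
  · intro t ht
    obtain ⟨v, hv⟩ := hxl t ht
    obtain ⟨w, hw⟩ := hyl t ht
    refine ⟨v + w, (hv.add hw).congr' ?_⟩
    filter_upwards [Ioo_mem_nhdsLT ht.1, nhdsLT_le_nhdsNE t (hfin t)] with s hs hs'
    exact (hd s ⟨⟨hs.1, hs.2.trans_le ht.2⟩, hs'⟩).symm

/-- The function that vanishes before `p`, has the slope `u` on `[p, m]`, and is constant
after `m`. -/
noncomputable def ramp (p m : ℝ) (u : E) (t : ℝ) : E := (max p (min t m) - p) • u

theorem ramp_of_le {p m t : ℝ} (u : E) (h : t ≤ p) : ramp p m u t = 0 := by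
  rw [ramp, max_eq_left ((min_le_left _ _).trans h), sub_self, zero_smul]

theorem ramp_of_mem {p m t : ℝ} (u : E) (h : t ∈ Icc p m) : ramp p m u t = (t - p) • u := by
  rw [ramp, min_eq_left h.2, max_eq_right h.1]

theorem ramp_of_ge {p m t : ℝ} (u : E) (hpm : p ≤ m) (h : m ≤ t) :
    ramp p m u t = (m - p) • u := by
  rw [ramp, min_eq_right h, max_eq_right hpm]

theorem norm_ramp_le {p m : ℝ} (u : E) (hpm : p ≤ m) (t : ℝ) :
    ‖ramp p m u t‖ ≤ (m - p) * ‖u‖ := by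
  rw [ramp, norm_smul, Real.norm_eq_abs, abs_of_nonneg (sub_nonneg.2 (le_max_left _ _))]
  gcongr
  exact max_le hpm (min_le_right _ _)

theorem hasDerivAt_ramp_of_lt {p m t : ℝ} (u : E) (h : t < p) :
    HasDerivAt (ramp p m u) 0 t :=
  (hasDerivAt_const t (0 : E)).congr_of_eventuallyEq <| by
    filter_upwards [Iio_mem_nhds h] with s hs using ramp_of_le u (le_of_lt hs)

theorem hasDerivAt_ramp_of_mem {p m t : ℝ} (u : E) (h : t ∈ Ioo p m) :
    HasDerivAt (ramp p m u) u t := by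
  have : HasDerivAt (fun s : ℝ => (s - p) • u) u t := by
    simpa using ((hasDerivAt_id t).sub_const p).smul_const u
  refine this.congr_of_eventuallyEq ?_
  filter_upwards [Ioo_mem_nhds h.1 h.2] with s hs using ramp_of_mem u (Ioo_subset_Icc_self hs)

theorem hasDerivAt_ramp_of_gt {p m t : ℝ} (u : E) (hpm : p ≤ m) (h : m < t) :
    HasDerivAt (ramp p m u) 0 t :=
  (hasDerivAt_const t ((m - p) • u)).congr_of_eventuallyEq <| by
    filter_upwards [Ioi_mem_nhds h] with s hs using ramp_of_ge u hpm (le_of_lt hs)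

theorem exists_deriv_ramp_eventuallyEq_right {p m : ℝ} (u : E) (hpm : p ≤ m) (t : ℝ) :
    ∃ v, deriv (ramp p m u) =ᶠ[𝓝[>] t] fun _ => v := by
  rcases lt_or_ge t p with h | h
  · refine ⟨0, ?_⟩
    filter_upwards [Ioo_mem_nhdsGT h] with s hs using (hasDerivAt_ramp_of_lt u hs.2).deriv
  rcases lt_or_ge t m with h' | h'
  · refine ⟨u, ?_⟩
    filter_upwards [Ioo_mem_nhdsGT h'] with s hs
    exact (hasDerivAt_ramp_of_mem u ⟨h.trans_lt hs.1, hs.2⟩).deriv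
  · refine ⟨0, ?_⟩
    filter_upwards [self_mem_nhdsWithin] with s hs
    exact (hasDerivAt_ramp_of_gt u hpm (h'.trans_lt hs)).deriv

theorem exists_deriv_ramp_eventuallyEq_left {p m : ℝ} (u : E) (hpm : p ≤ m) (t : ℝ) :
    ∃ v, deriv (ramp p m u) =ᶠ[𝓝[<] t] fun _ => v := by
  rcases le_or_gt t p with h | h
  · refine ⟨0, ?_⟩
    filter_upwards [self_mem_nhdsWithin] with s hs
    exact (hasDerivAt_ramp_of_lt u (lt_of_lt_of_le hs h)).deriv
  rcases le_or_gt t m with h' | h'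
  · refine ⟨u, ?_⟩
    filter_upwards [Ioo_mem_nhdsLT h] with s hs
    exact (hasDerivAt_ramp_of_mem u ⟨hs.1, hs.2.trans_le h'⟩).deriv
  · refine ⟨0, ?_⟩
    filter_upwards [Ioo_mem_nhdsLT h'] with s hs using (hasDerivAt_ramp_of_gt u hpm hs.1).deriv

theorem exists_hasDerivAt_ramp {p m t : ℝ} (u : E) (hpm : p ≤ m) (hp : t ≠ p) (hm : t ≠ m) :
    ∃ v, ∀ᶠ s in 𝓝 t, HasDerivAt (ramp p m u) v s := by
  rcases lt_or_gt_of_ne hp with h | h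
  · exact ⟨0, by filter_upwards [Iio_mem_nhds h] with s hs using hasDerivAt_ramp_of_lt u hs⟩
  rcases lt_or_gt_of_ne hm with h' | h'
  · exact ⟨u, by filter_upwards [Ioo_mem_nhds h h'] with s hs using hasDerivAt_ramp_of_mem u hs⟩
  · exact ⟨0, by filter_upwards [Ioi_mem_nhds h'] with s hs using hasDerivAt_ramp_of_gt u hpm hs⟩

theorem piecewiseSmooth_ramp (t₀ t₁ : ℝ) {p m : ℝ} (u : E) (hpm : p ≤ m) :
    PiecewiseSmooth t₀ t₁ (ramp p m u) := by
  classical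
  have hcont : Continuous (ramp p m u) := by unfold ramp; fun_prop
  -- Corners must be interior points, while `p` or `m` may be an endpoint of the interval; hence the
  -- filter.
  have hne : ∀ t ∈ Ioo t₀ t₁ \ (((({p, m} : Finset ℝ).filter (· ∈ Ioo t₀ t₁)) : Finset ℝ) : Set ℝ),
      t ≠ p ∧ t ≠ m := by
    intro t ht
    constructor <;>
    · rintro rfl
      exact ht.2 (by simpa using ht.1)
  refine ⟨hcont.continuousOn, ⟨({p, m} : Finset ℝ).filter (· ∈ Ioo t₀ t₁), ?_, ?_, ?_⟩, ?_, ?_⟩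
  · intro t ht
    exact (Finset.mem_filter.1 ht).2
  · intro t ht
    obtain ⟨v, hv⟩ := exists_hasDerivAt_ramp u hpm (hne t ht).1 (hne t ht).2
    exact hv.self_of_nhds.differentiableAt
  · intro t ht
    obtain ⟨v, hv⟩ := exists_hasDerivAt_ramp u hpm (hne t ht).1 (hne t ht).2
    have : deriv (ramp p m u) =ᶠ[𝓝 t] fun _ => v := hv.mono fun s hs => hs.deriv
    exact (continuousAt_const.congr this.symm).continuousWithinAt
  · intro t _
    obtain ⟨v, hv⟩ := exists_deriv_ramp_eventuallyEq_right u hpm t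
    exact ⟨v, tendsto_const_nhds.congr' hv.symm⟩
  · intro t _
    obtain ⟨v, hv⟩ := exists_deriv_ramp_eventuallyEq_left u hpm t
    exact ⟨v, tendsto_const_nhds.congr' hv.symm⟩

/-- The integrand of the functional is integrable along a piecewise smooth function. -/
theorem PiecewiseSmooth.intervalIntegrable {a b t₀ t₁ : ℝ} (hI : Icc t₀ t₁ ⊆ Ioo a b)
    (ht : t₀ < t₁) {L : ℝ → E → E → ℝ}
    (hL : ContinuousOn (fun p : ℝ × E × E => L p.1 p.2.1 p.2.2) (Ioo a b ×ˢ univ))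
    {x : ℝ → E} (hx : PiecewiseSmooth t₀ t₁ x) :
    IntervalIntegrable (fun t => L t (x t) (deriv x t)) MeasureTheory.volume t₀ t₁ := by
  obtain ⟨hxc, ⟨τ, hτ, hxd, hxdc⟩, hxr, hxl⟩ := hx
  have hS : MeasurableSet (Ioo t₀ t₁ \ (τ : Set ℝ)) :=
    measurableSet_Ioo.diff τ.finite_toSet.measurableSet
  have hIoo : Ioo t₀ t₁ ⊆ Icc t₀ t₁ := Ioo_subset_Icc_self
  have hmeas : MeasureTheory.AEStronglyMeasurable (fun t => L t (x t) (deriv x t))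
      (MeasureTheory.volume.restrict (Ioo t₀ t₁ \ (τ : Set ℝ))) := by
    refine ContinuousOn.aestronglyMeasurable ?_ hS
    refine hL.comp (continuousOn_id.prodMk ((hxc.mono (sdiff_subset.trans hIoo)).prodMk hxdc)) ?_
    exact fun t ht => ⟨hI (hIoo ht.1), trivial⟩
  have hlim : ∀ t ∈ Icc t₀ t₁, ∀ S : Set ℝ, S ⊆ Icc t₀ t₁ → ∀ v : E,
      Tendsto (deriv x) (𝓝[S] t) (𝓝 v) →
      ∃ C, ∀ᶠ s in 𝓝[S] t, ‖L s (x s) (deriv x s)‖ ≤ C := by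
    intro t ht S hS v hv
    have h1 : Tendsto (fun s => (s, x s, deriv x s)) (𝓝[S] t) (𝓝 (t, x t, v)) :=
      (tendsto_id.mono_left nhdsWithin_le_nhds).prodMk_nhds
        (((hxc t ht).mono_left (nhdsWithin_mono t hS)).prodMk_nhds hv)
    have h2 := (hL.continuousAt ((isOpen_domain a b).mem_nhds
      (show (t, x t, v) ∈ Ioo a b ×ˢ univ from ⟨hI ht, trivial⟩))).tendsto.comp h1
    exact ⟨_, (h2.norm.eventually_lt_const (lt_add_one _)).mono fun s hs => le_of_lt hs⟩
  -- One-sided limits make the integrand bounded near each point, and compactness makes the bound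
  -- global. The value at the point itself, where `deriv x` may be the default `0`, enters through a
  -- maximum.
  have hbd : ∃ C, ∀ s ∈ Icc t₀ t₁, s ∈ Ioo t₀ t₁ → ‖L s (x s) (deriv x s)‖ ≤ C := by
    refine isCompact_Icc.induction_on
      (p := fun A => ∃ C, ∀ s ∈ A, s ∈ Ioo t₀ t₁ → ‖L s (x s) (deriv x s)‖ ≤ C) ⟨0, by simp⟩
      (fun A B hAB ⟨C, hC⟩ => ⟨C, fun s hs => hC s (hAB hs)⟩)
      (fun A B ⟨C, hC⟩ ⟨D, hD⟩ => ⟨max C D, fun s hs hs' => hs.elim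
        (fun h => (hC s h hs').trans (le_max_left _ _))
        (fun h => (hD s h hs').trans (le_max_right _ _))⟩) ?_
    intro t ht'
    have hR : ∃ C, ∀ᶠ s in 𝓝[>] t, s ∈ Ioo t₀ t₁ → ‖L s (x s) (deriv x s)‖ ≤ C := by
      rcases eq_or_lt_of_le ht'.2 with rfl | h
      · exact ⟨0, by filter_upwards [self_mem_nhdsWithin] with s hs hs'
                     exact absurd hs'.2 (not_lt.2 (le_of_lt hs))⟩
      · obtain ⟨v, hv⟩ := hxr t ⟨ht'.1, h⟩
        rw [← nhdsWithin_Ioo_eq_nhdsGT h] at hv ⊢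
        obtain ⟨C, hC⟩ := hlim t ht' _ ((Ioo_subset_Ioo_left ht'.1).trans hIoo) v hv
        exact ⟨C, hC.mono fun s hs _ => hs⟩
    have hLf : ∃ C, ∀ᶠ s in 𝓝[<] t, s ∈ Ioo t₀ t₁ → ‖L s (x s) (deriv x s)‖ ≤ C := by
      rcases eq_or_lt_of_le ht'.1 with rfl | h
      · exact ⟨0, by filter_upwards [self_mem_nhdsWithin] with s hs hs'
                     exact absurd hs'.1 (not_lt.2 (le_of_lt hs))⟩
      · obtain ⟨v, hv⟩ := hxl t ⟨h, ht'.2⟩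
        rw [← nhdsWithin_Ioo_eq_nhdsLT h] at hv ⊢
        obtain ⟨C, hC⟩ := hlim t ht' _ ((Ioo_subset_Ioo_right ht'.2).trans hIoo) v hv
        exact ⟨C, hC.mono fun s hs _ => hs⟩
    obtain ⟨C, hC⟩ := hR
    obtain ⟨D, hD⟩ := hLf
    have : ∀ᶠ s in 𝓝[≠] t, s ∈ Ioo t₀ t₁ →
        ‖L s (x s) (deriv x s)‖ ≤ max (max C D) ‖L t (x t) (deriv x t)‖ := by
      rw [← nhdsLT_sup_nhdsGT, eventually_sup]
      refine ⟨hD.mono fun s hs h => (hs h).trans ?_, hC.mono fun s hs h => (hs h).trans ?_⟩ <;>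
      simp
    refine ⟨_, mem_nhdsWithin_of_mem_nhds (?_ : ∀ᶠ s in 𝓝 t, s ∈ Ioo t₀ t₁ →
      ‖L s (x s) (deriv x s)‖ ≤ max (max C D) ‖L t (x t) (deriv x t)‖), _, fun s hs => hs⟩
    filter_upwards [eventually_nhdsWithin_iff.1 this] with s hs
    rcases eq_or_ne s t with rfl | hst
    · exact fun _ => le_max_right _ _
    · exact hs hst
  obtain ⟨C, hC⟩ := hbd
  rw [intervalIntegrable_iff_integrableOn_Ioo_of_le ht.le]
  have h1 : MeasureTheory.IntegrableOn (fun t => L t (x t) (deriv x t))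
      (Ioo t₀ t₁ \ (τ : Set ℝ)) MeasureTheory.volume := by
    refine MeasureTheory.Integrable.mono' (g := fun _ => C) ?_ hmeas ?_
    · exact (MeasureTheory.integrableOn_const (by simp)).mono_set sdiff_subset
    · exact (MeasureTheory.ae_restrict_iff' hS).2 (Eventually.of_forall
        fun s hs => hC s (hIoo hs.1) hs.1)
  refine h1.congr_set_ae ?_
  refine (MeasureTheory.sdiff_null_ae_eq_self ?_).symm
  exact τ.finite_toSet.measure_zero _

end Variation

/-! ### Tent variations and the vanishing of the first variation -/

section FirstVariation

variable {E : Type*} [NormedAddCommGroup E] [NormedSpace ℝ E] {a b t₀ t₁ : ℝ} {L : ℝ → E → E → ℝ}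

theorem functional_eq_add {x : ℝ → E} {p m q : ℝ} (ht₀ : t₀ ≤ p) (hpm : p ≤ m) (hmq : m ≤ q)
    (ht₁ : q ≤ t₁)
    (hx : IntervalIntegrable (fun t => L t (x t) (deriv x t)) MeasureTheory.volume t₀ t₁) :
    functional t₀ t₁ L x = (∫ t in t₀..p, L t (x t) (deriv x t))
      + (∫ t in p..m, L t (x t) (deriv x t)) + (∫ t in m..q, L t (x t) (deriv x t))
      + ∫ t in q..t₁, L t (x t) (deriv x t) := by
  have key : ∀ c ∈ Icc t₀ t₁, ∀ d ∈ Icc t₀ t₁,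
      IntervalIntegrable (fun t => L t (x t) (deriv x t)) MeasureTheory.volume c d :=
    fun c hc d hd => hx.mono_set ((uIcc_subset_Icc hc hd).trans Icc_subset_uIcc)
  have m0 : t₀ ∈ Icc t₀ t₁ := ⟨le_rfl, by linarith⟩
  have m1 : p ∈ Icc t₀ t₁ := ⟨by linarith, by linarith⟩
  have m2 : m ∈ Icc t₀ t₁ := ⟨by linarith, by linarith⟩
  have m3 : q ∈ Icc t₀ t₁ := ⟨by linarith, by linarith⟩
  have m4 : t₁ ∈ Icc t₀ t₁ := ⟨by linarith, by linarith⟩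
  rw [functional, intervalIntegral.integral_add_adjacent_intervals (key _ m0 _ m1) (key _ m1 _ m2),
    intervalIntegral.integral_add_adjacent_intervals (key _ m0 _ m2) (key _ m2 _ m3),
    intervalIntegral.integral_add_adjacent_intervals (key _ m0 _ m3) (key _ m3 _ m4)]

/-- Comparison of a strong local minimum with its variation by a tent function. -/
theorem integral_le_integral_tent (hI : Icc t₀ t₁ ⊆ Ioo a b)
    (hL : ContinuousOn (fun p : ℝ × E × E => L p.1 p.2.1 p.2.2) (Ioo a b ×ˢ univ))
    {x₀ x₁ : E} {xbar : ℝ → E} (hadm : Admissible t₀ t₁ x₀ x₁ xbar) {δ : ℝ}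
    (hδ : ∀ x : ℝ → E, Admissible t₀ t₁ x₀ x₁ x → (∀ t ∈ Icc t₀ t₁, ‖x t - xbar t‖ ≤ δ) →
      functional t₀ t₁ L xbar ≤ functional t₀ t₁ L x)
    {p m q : ℝ} (ht₀ : t₀ ≤ p) (hpm : p < m) (hmq : m < q) (ht₁ : q ≤ t₁) {v : ℝ → E}
    (hv : ∀ t ∈ Ioo p q, HasDerivAt xbar (v t) t) {u w : E}
    (huw : (m - p) • u + (q - m) • w = 0) (hsmall : (m - p) * ‖u‖ + (q - m) * ‖w‖ ≤ δ) :
    (∫ t in p..m, L t (xbar t) (v t)) + (∫ t in m..q, L t (xbar t) (v t)) ≤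
      (∫ t in p..m, L t (xbar t + (t - p) • u) (v t + u))
        + ∫ t in m..q, L t (xbar t + (t - q) • w) (v t + w) := by
  have ht : t₀ < t₁ := by linarith
  -- The tent as a sum of two ramps; `huw` says that their final values cancel.
  set h : ℝ → E := fun t => ramp p m u t + ramp m q w t with hh
  set X : ℝ → E := fun t => xbar t + h t with hX
  have h_le : ∀ t ≤ p, h t = 0 := fun t htp => by
    simp [hh, ramp_of_le u htp, ramp_of_le w (htp.trans hpm.le)]
  have h_ge : ∀ t, q ≤ t → h t = 0 := fun t htq => by
    simp [hh, ramp_of_ge u hpm.le (hmq.le.trans htq), ramp_of_ge w hmq.le htq, huw]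
  have h_left : ∀ t ∈ Icc p m, h t = (t - p) • u := fun t htm => by
    simp [hh, ramp_of_mem u htm, ramp_of_le w htm.2]
  have h_right : ∀ t ∈ Icc m q, h t = (t - q) • w := fun t htm => by
    simp only [hh, ramp_of_mem w htm, ramp_of_ge u hpm.le htm.1]
    rw [eq_neg_of_add_eq_zero_left huw]
    module
  have hXps : PiecewiseSmooth t₀ t₁ X :=
    hadm.1.add ((piecewiseSmooth_ramp t₀ t₁ u hpm.le).add (piecewiseSmooth_ramp t₀ t₁ w hmq.le))
  have hXadm : Admissible t₀ t₁ x₀ x₁ X :=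
    ⟨hXps, by simp [hX, h_le t₀ ht₀, hadm.2.1], by simp [hX, h_ge t₁ ht₁, hadm.2.2]⟩
  have hXJ := hδ X hXadm fun t _ => by
    have : X t - xbar t = h t := by simp [hX]
    rw [this]
    exact (norm_add_le _ _).trans ((add_le_add (norm_ramp_le u hpm.le t)
      (norm_ramp_le w hmq.le t)).trans hsmall)
  rw [functional_eq_add ht₀ hpm.le hmq.le ht₁ (hadm.1.intervalIntegrable hI ht hL),
    functional_eq_add ht₀ hpm.le hmq.le ht₁ (hXps.intervalIntegrable hI ht hL)] at hXJ
  have e1 : ∫ t in t₀..p, L t (X t) (deriv X t) = ∫ t in t₀..p, L t (xbar t) (deriv xbar t) := by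
    refine intervalIntegral.integral_congr_Ioo_of_le ht₀ fun t ht' => ?_
    have : X =ᶠ[𝓝 t] xbar := by
      filter_upwards [Iio_mem_nhds ht'.2] with s hs
      simp [hX, h_le s (le_of_lt hs)]
    simp only [this.deriv_eq, this.eq_of_nhds]
  have e4 : ∫ t in q..t₁, L t (X t) (deriv X t) = ∫ t in q..t₁, L t (xbar t) (deriv xbar t) := by
    refine intervalIntegral.integral_congr_Ioo_of_le ht₁ fun t ht' => ?_
    have : X =ᶠ[𝓝 t] xbar := by
      filter_upwards [Ioi_mem_nhds ht'.1] with s hs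
      simp [hX, h_ge s (le_of_lt hs)]
    simp only [this.deriv_eq, this.eq_of_nhds]
  have e2 : ∫ t in p..m, L t (X t) (deriv X t)
      = ∫ t in p..m, L t (xbar t + (t - p) • u) (v t + u) := by
    refine intervalIntegral.integral_congr_Ioo_of_le hpm.le fun t ht' => ?_
    have h1 : HasDerivAt (ramp p m u) u t := hasDerivAt_ramp_of_mem u ht'
    have h2 : HasDerivAt (ramp m q w) 0 t := hasDerivAt_ramp_of_lt w ht'.2
    have h3 : HasDerivAt X (v t + (u + 0)) t := (hv t ⟨ht'.1, ht'.2.trans hmq⟩).add (h1.add h2)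
    simp only [h3.deriv, show X t = xbar t + h t from rfl, h_left t (Ioo_subset_Icc_self ht'), add_zero]
  have e3 : ∫ t in m..q, L t (X t) (deriv X t)
      = ∫ t in m..q, L t (xbar t + (t - q) • w) (v t + w) := by
    refine intervalIntegral.integral_congr_Ioo_of_le hmq.le fun t ht' => ?_
    have h1 : HasDerivAt (ramp p m u) 0 t := hasDerivAt_ramp_of_gt u hpm.le ht'.1
    have h2 : HasDerivAt (ramp m q w) w t := hasDerivAt_ramp_of_mem w ht'
    have h3 : HasDerivAt X (v t + (0 + w)) t := (hv t ⟨hpm.trans ht'.1, ht'.2⟩).add (h1.add h2)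
    simp only [h3.deriv, show X t = xbar t + h t from rfl, h_right t (Ioo_subset_Icc_self ht'), zero_add]
  have f2 : ∫ t in p..m, L t (xbar t) (deriv xbar t) = ∫ t in p..m, L t (xbar t) (v t) :=
    intervalIntegral.integral_congr_Ioo_of_le hpm.le fun t ht' => by
      simp only [(hv t ⟨ht'.1, ht'.2.trans hmq⟩).deriv]
  have f3 : ∫ t in m..q, L t (xbar t) (deriv xbar t) = ∫ t in m..q, L t (xbar t) (v t) :=
    intervalIntegral.integral_congr_Ioo_of_le hmq.le fun t ht' => by
      simp only [(hv t ⟨hpm.trans ht'.1, ht'.2⟩).deriv]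
  rw [e1, e2, e3, e4, f2, f3] at hXJ
  linarith

/-- Differentiation of the functional over a short interval in the direction of a variation. -/
theorem hasDerivAt_integral_variation
    (hL : ContDiffOn ℝ 2 (fun p : ℝ × E × E => L p.1 p.2.1 p.2.2) (Ioo a b ×ˢ univ))
    {p q : ℝ} (hpq : uIcc p q ⊆ Ioo a b) {x y h k : ℝ → E} (hx : ContinuousOn x (uIcc p q))
    (hy : ContinuousOn y (uIcc p q)) (hh : ContinuousOn h (uIcc p q))
    (hk : ContinuousOn k (uIcc p q)) :
    HasDerivAt (fun c : ℝ => ∫ t in p..q, L t (x t + c • h t) (y t + c • k t))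
      (∫ t in p..q, (Lx L t (x t) (y t) (h t) + Lv L t (x t) (y t) (k t))) 0 := by
  set f : ℝ × E × E → ℝ := fun p => L p.1 p.2.1 p.2.2 with hf
  have hU := isOpen_domain (E := E) a b
  have hsub : uIoc p q ⊆ uIcc p q := uIoc_subset_uIcc
  have hγ : ∀ c : ℝ, ContinuousOn (fun t => (t, x t + c • h t, y t + c • k t)) (uIcc p q) :=
    fun c => continuousOn_id.prodMk ((hx.add (hh.const_smul c)).prodMk (hy.add (hk.const_smul c)))
  have hF : ∀ c : ℝ, ContinuousOn (fun t => L t (x t + c • h t) (y t + c • k t)) (uIcc p q) :=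
    fun c => hL.continuousOn.comp (hγ c) fun t ht => ⟨hpq ht, trivial⟩
  have hdf : ContinuousOn (fderiv ℝ f) (Ioo a b ×ˢ univ) :=
    (hL.fderiv_of_isOpen hU (m := 1) (by norm_num)).continuousOn
  -- Joint continuity on a compact rectangle gives the constant that dominates the derivative under
  -- the integral sign.
  have hF' : ContinuousOn (fun z : ℝ × ℝ => fderiv ℝ f (z.2, x z.2 + z.1 • h z.2,
      y z.2 + z.1 • k z.2) (0, h z.2, k z.2)) (Icc (-1) 1 ×ˢ uIcc p q) := by
    have hm : MapsTo Prod.snd (Icc (-1 : ℝ) 1 ×ˢ uIcc p q) (uIcc p q) := fun z hz => hz.2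
    have hx2 := hx.comp continuousOn_snd hm
    have hy2 := hy.comp continuousOn_snd hm
    have hh2 := hh.comp continuousOn_snd hm
    have hk2 := hk.comp continuousOn_snd hm
    refine ContinuousOn.clm_apply (hdf.comp (continuousOn_snd.prodMk
      ((hx2.add (continuousOn_fst.smul hh2)).prodMk (hy2.add (continuousOn_fst.smul hk2)))) ?_)
      (continuousOn_const.prodMk (hh2.prodMk hk2))
    exact fun z hz => ⟨hpq hz.2, trivial⟩
  obtain ⟨C, hC⟩ := (isCompact_Icc.prod isCompact_uIcc).exists_bound_of_continuousOn hF'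
  have key := intervalIntegral.hasDerivAt_integral_of_dominated_loc_of_deriv_le
    (μ := MeasureTheory.volume) (a := p) (b := q) (bound := fun _ => C) (s := Icc (-1 : ℝ) 1)
    (F := fun c t => L t (x t + c • h t) (y t + c • k t)) (x₀ := (0 : ℝ))
    (F' := fun c t => fderiv ℝ f (t, x t + c • h t, y t + c • k t) (0, h t, k t))
    (Icc_mem_nhds (by norm_num) (by norm_num))
    (Eventually.of_forall fun c =>
      ((hF c).mono hsub).aestronglyMeasurable measurableSet_uIoc)
    (hF 0).intervalIntegrable
    ((hF'.comp (continuousOn_const.prodMk continuousOn_id)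
      (fun t ht => ⟨by simp, hsub ht⟩ : MapsTo (fun t : ℝ => ((0 : ℝ), t)) (uIoc p q)
        (Icc (-1) 1 ×ˢ uIcc p q))).aestronglyMeasurable measurableSet_uIoc)
    (Eventually.of_forall fun t ht c hc => hC (c, t) ⟨hc, hsub ht⟩)
    intervalIntegrable_const
    (Eventually.of_forall fun t ht c _ => by
      have h1 : HasDerivAt (fun c : ℝ => (t, x t + c • h t, y t + c • k t)) (0, h t, k t) c := by
        refine (hasDerivAt_const c t).prodMk (HasDerivAt.prodMk ?_ ?_)
        · simpa using ((hasDerivAt_id c).smul_const (h t)).const_add (x t)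
        · simpa using ((hasDerivAt_id c).smul_const (k t)).const_add (y t)
      exact (differentiableAt_integrand hL (hpq (hsub ht)) _ _).hasFDerivAt.comp_hasDerivAt c h1)
  refine key.2.congr_deriv ?_
  refine intervalIntegral.integral_congr fun t ht => ?_
  simp only [zero_smul, add_zero]
  exact fderiv_integrand_apply hL (hpq ht) _ _ _ _

/-- The increment of the integrand under the variation with the value `ω • ζ` and the slope `ζ`,
without its linear part. -/
noncomputable def excess (L : ℝ → E → E → ℝ) (x v : ℝ → E) (t ω : ℝ) (ζ : E) : ℝ :=
  L t (x t + ω • ζ) (v t + ζ) - L t (x t) (v t)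
    - (Lx L t (x t) (v t) (ω • ζ) + Lv L t (x t) (v t) ζ)

theorem continuousOn_linearPart
    (hL : ContDiffOn ℝ 2 (fun p : ℝ × E × E => L p.1 p.2.1 p.2.2) (Ioo a b ×ˢ univ))
    {S : Set ℝ} (hS : S ⊆ Ioo a b) {x v h k : ℝ → E} (hx : ContinuousOn x S)
    (hv : ContinuousOn v S) (hh : ContinuousOn h S) (hk : ContinuousOn k S) :
    ContinuousOn (fun t => Lx L t (x t) (v t) (h t) + Lv L t (x t) (v t) (k t)) S := by
  have h1 : ContinuousOn (fderiv ℝ (fun p : ℝ × E × E => L p.1 p.2.1 p.2.2)) (Ioo a b ×ˢ univ) :=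
    (hL.fderiv_of_isOpen (isOpen_domain a b) (m := 1) (by norm_num)).continuousOn
  refine ((h1.comp (continuousOn_id.prodMk (hx.prodMk hv))
    (fun t ht => ⟨hS ht, trivial⟩)).clm_apply
      (continuousOn_const (c := (0 : ℝ)).prodMk (hh.prodMk hk))).congr fun t ht => ?_
  exact (fderiv_integrand_apply hL (hS ht) _ _ _ _).symm

theorem continuousOn_excess
    (hL : ContDiffOn ℝ 2 (fun p : ℝ × E × E => L p.1 p.2.1 p.2.2) (Ioo a b ×ˢ univ))
    {S : Set ℝ} (hS : S ⊆ Ioo a b) {x v : ℝ → E} (hx : ContinuousOn x S)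
    (hv : ContinuousOn v S) (c : ℝ) (ζ : E) :
    ContinuousOn (fun t => excess L x v t (t - c) ζ) S := by
  have hω : ContinuousOn (fun t : ℝ => (t - c) • ζ) S := by fun_prop
  refine ContinuousOn.sub (ContinuousOn.sub ?_ ?_)
    (continuousOn_linearPart hL hS hx hv hω continuousOn_const)
  · exact hL.continuousOn.comp (continuousOn_id.prodMk
      ((hx.add hω).prodMk (hv.add continuousOn_const))) fun t ht => ⟨hS ht, trivial⟩
  · exact hL.continuousOn.comp (continuousOn_id.prodMk (hx.prodMk hv))
      fun t ht => ⟨hS ht, trivial⟩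

/-- The increment of the functional under a small tent variation, without its linear part, is
nonnegative, because the first variation of the functional vanishes. -/
theorem integral_excess_nonneg (hI : Icc t₀ t₁ ⊆ Ioo a b)
    (hL : ContDiffOn ℝ 2 (fun p : ℝ × E × E => L p.1 p.2.1 p.2.2) (Ioo a b ×ˢ univ))
    {x₀ x₁ : E} {xbar : ℝ → E} (hadm : Admissible t₀ t₁ x₀ x₁ xbar) {δ : ℝ}
    (hδ : ∀ x : ℝ → E, Admissible t₀ t₁ x₀ x₁ x → (∀ t ∈ Icc t₀ t₁, ‖x t - xbar t‖ ≤ δ) →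
      functional t₀ t₁ L xbar ≤ functional t₀ t₁ L x)
    {p m q : ℝ} (ht₀ : t₀ ≤ p) (hpm : p < m) (hmq : m < q) (ht₁ : q ≤ t₁) {v : ℝ → E}
    (hvc : ContinuousOn v (Icc p q)) (hv : ∀ t ∈ Ioo p q, HasDerivAt xbar (v t) t) {u w : E}
    (huw : (m - p) • u + (q - m) • w = 0) (hsmall : (m - p) * ‖u‖ + (q - m) * ‖w‖ ≤ δ) :
    0 ≤ (∫ t in p..m, excess L xbar v t (t - p) u) + ∫ t in m..q, excess L xbar v t (t - q) w := by
  have hsub : Icc p q ⊆ Icc t₀ t₁ := Icc_subset_Icc ht₀ ht₁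
  have s1 : uIcc p m ⊆ Icc p q := by
    rw [uIcc_of_le hpm.le]; exact Icc_subset_Icc_right hmq.le
  have s2 : uIcc m q ⊆ Icc p q := by
    rw [uIcc_of_le hmq.le]; exact Icc_subset_Icc_left hpm.le
  have hxc : ContinuousOn xbar (Icc p q) := hadm.1.1.mono hsub
  have hd1 := hasDerivAt_integral_variation hL (s1.trans (hsub.trans hI)) (hxc.mono s1)
    (hvc.mono s1) (h := fun t => (t - p) • u) (k := fun _ => u) (by fun_prop) (by fun_prop)
  have hd2 := hasDerivAt_integral_variation hL (s2.trans (hsub.trans hI)) (hxc.mono s2)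
    (hvc.mono s2) (h := fun t => (t - q) • w) (k := fun _ => w) (by fun_prop) (by fun_prop)
  -- Scaling by `|c| ≤ 1` keeps the tent closed and within `δ`. The case `c = 1` is the final
  -- comparison; small `c` of both signs kill the linear part.
  have hcmp : ∀ c : ℝ, |c| ≤ 1 →
      (∫ t in p..m, L t (xbar t) (v t)) + (∫ t in m..q, L t (xbar t) (v t)) ≤
      (∫ t in p..m, L t (xbar t + c • (t - p) • u) (v t + c • u))
        + ∫ t in m..q, L t (xbar t + c • (t - q) • w) (v t + c • w) := fun c hc => by
    have := integral_le_integral_tent hI hL.continuousOn hadm hδ ht₀ hpm hmq ht₁ hv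
      (u := c • u) (w := c • w)
      (by rw [smul_comm, smul_comm _ c w, ← smul_add, huw, smul_zero])
      (by
        rw [norm_smul, norm_smul, Real.norm_eq_abs]
        have h1 : 0 ≤ (m - p) * ‖u‖ := mul_nonneg (by linarith) (norm_nonneg _)
        have h2 : 0 ≤ (q - m) * ‖w‖ := mul_nonneg (by linarith) (norm_nonneg _)
        nlinarith [abs_nonneg c])
    simpa only [smul_comm _ c] using this
  have hmin : IsLocalMin (fun c : ℝ =>
      (∫ t in p..m, L t (xbar t + c • (t - p) • u) (v t + c • u))
        + ∫ t in m..q, L t (xbar t + c • (t - q) • w) (v t + c • w)) 0 := by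
    filter_upwards [Metric.ball_mem_nhds (0 : ℝ) one_pos] with c hc
    simpa using hcmp c (by simpa using (le_of_lt (Metric.mem_ball.1 hc)))
  have hzero := hmin.hasDerivAt_eq_zero (hd1.add hd2)
  have h1 := hcmp 1 (by simp)
  simp only [one_smul] at h1
  have hint : ∀ {c d : ℝ} (r : ℝ) (ζ : E), uIcc c d ⊆ Icc p q →
      (∫ t in c..d, excess L xbar v t (t - r) ζ)
        = (∫ t in c..d, L t (xbar t + (t - r) • ζ) (v t + ζ)) - (∫ t in c..d, L t (xbar t) (v t))
          - ∫ t in c..d, (Lx L t (xbar t) (v t) ((t - r) • ζ) + Lv L t (xbar t) (v t) ζ) := by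
    intro c d r ζ hcd
    have hS := hcd.trans (hsub.trans hI)
    have hx' := hxc.mono hcd
    have hv' := hvc.mono hcd
    have hω : ContinuousOn (fun t : ℝ => (t - r) • ζ) (uIcc c d) := by fun_prop
    have i1 : ContinuousOn (fun t => L t (xbar t + (t - r) • ζ) (v t + ζ)) (uIcc c d) :=
      hL.continuousOn.comp (continuousOn_id.prodMk
        ((hx'.add hω).prodMk (hv'.add continuousOn_const))) fun t ht => ⟨hS ht, trivial⟩
    have i2 : ContinuousOn (fun t => L t (xbar t) (v t)) (uIcc c d) :=
      hL.continuousOn.comp (continuousOn_id.prodMk (hx'.prodMk hv')) fun t ht => ⟨hS ht, trivial⟩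
    have i3 := continuousOn_linearPart hL hS hx' hv' hω (continuousOn_const (c := ζ))
    rw [← intervalIntegral.integral_sub i1.intervalIntegrable i2.intervalIntegrable,
      ← intervalIntegral.integral_sub (i1.fun_sub i2).intervalIntegrable i3.intervalIntegrable]
    rfl
  rw [hint p u s1, hint q w s2]
  linarith

end FirstVariation

/-! ### Expansion of the increment to third order in the length of the tent -/

section Expansion

/-- The quadratic is integrated exactly and the error bounded by its supremum. No order of `p` and
`q` is assumed, so the tents on both sides of `θ` are covered. -/
theorem abs_integral_sub_quadratic_le {f : ℝ → ℝ} {A B C κ p q θ : ℝ}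
    (hf : IntervalIntegrable f MeasureTheory.volume p q)
    (h : ∀ t ∈ uIoc p q, |f t - (A + B * (t - θ) + C * (t - θ) ^ 2)| ≤ κ) :
    |(∫ t in p..q, f t) - (A * (q - p) + B / 2 * ((q - θ) ^ 2 - (p - θ) ^ 2)
      + C / 3 * ((q - θ) ^ 3 - (p - θ) ^ 3))| ≤ κ * |q - p| := by
  have hP : ∀ t : ℝ, HasDerivAt
      (fun t => A * (t - θ) + B / 2 * (t - θ) ^ 2 + C / 3 * (t - θ) ^ 3)
      (A + B * (t - θ) + C * (t - θ) ^ 2) t := fun t => by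
    have h1 : HasDerivAt (fun t : ℝ => t - θ) 1 t := (hasDerivAt_id t).sub_const θ
    refine (((h1.const_mul A).add ((h1.pow 2).const_mul (B / 2))).add
      ((h1.pow 3).const_mul (C / 3))).congr_deriv ?_
    push_cast
    ring
  have hi : IntervalIntegrable (fun t : ℝ => A + B * (t - θ) + C * (t - θ) ^ 2)
      MeasureTheory.volume p q := Continuous.intervalIntegrable (by fun_prop) _ _
  have hint := intervalIntegral.integral_eq_sub_of_hasDerivAt (fun t _ => hP t) hi
  have hle := intervalIntegral.norm_integral_le_of_norm_le_const
    (f := fun t => f t - (A + B * (t - θ) + C * (t - θ) ^ 2)) (C := κ) h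
  rw [intervalIntegral.integral_sub hf hi, hint, Real.norm_eq_abs] at hle
  convert hle using 3
  ring

/-- The signs of the leading coefficients of a function that is nonnegative on the right of `0`. -/
theorem nonneg_coeff_of_expansion {F : ℝ → ℝ} {w g : ℝ}
    (h : ∀ κ > 0, ∃ r > 0, ∀ ε, 0 < ε → ε < r →
      |F ε - (ε ^ 2 / 2 * w + ε ^ 3 / 6 * g)| ≤ κ * ε ^ 3)
    (hF : ∃ r > 0, ∀ ε, 0 < ε → ε < r → 0 ≤ F ε) : 0 ≤ w ∧ (w = 0 → 0 ≤ g) := by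
  obtain ⟨r₀, hr₀, hF⟩ := hF
  constructor
  · obtain ⟨r, hr, H⟩ := h 1 one_pos
    -- With `κ = 1`, this is the upper bound for `F ε` divided by `ε² / 2`.
    have hlim : Tendsto (fun ε : ℝ => w + ε * (g / 3 + 2)) (𝓝[>] 0) (𝓝 w) := by
      have : Continuous fun ε : ℝ => w + ε * (g / 3 + 2) := by fun_prop
      simpa using (this.tendsto 0).mono_left nhdsWithin_le_nhds
    refine ge_of_tendsto hlim ?_
    filter_upwards [Ioo_mem_nhdsGT (lt_min hr hr₀)] with ε hε
    have h1 := (abs_le.1 (H ε hε.1 (hε.2.trans_le (min_le_left _ _)))).2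
    have h2 := hF ε hε.1 (hε.2.trans_le (min_le_right _ _))
    have h3 : 0 ≤ ε ^ 2 * (w + ε * (g / 3 + 2)) := by nlinarith
    exact nonneg_of_mul_nonneg_right h3 (pow_pos hε.1 2)
  · rintro rfl
    by_contra! hg
    -- An error of half the size of the leading term leaves `F ε ≤ ε³ g / 12 < 0`.
    obtain ⟨r, hr, H⟩ := h (-g / 12) (by linarith)
    obtain ⟨ε, hε⟩ := exists_between (lt_min hr hr₀)
    have h1 := (abs_le.1 (H ε hε.1 (hε.2.trans_le (min_le_left _ _)))).2
    have h2 := hF ε hε.1 (hε.2.trans_le (min_le_right _ _))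
    have h3 : 0 < ε ^ 3 := pow_pos hε.1 3
    nlinarith

variable {E : Type*} [NormedAddCommGroup E] [NormedSpace ℝ E] {a b : ℝ} {L : ℝ → E → E → ℝ}
  {x : ℝ → E} {s : Set ℝ} {θ : ℝ}

theorem twiceDiffWithinAt_curve (hs : UniqueDiffOn ℝ s) (hθ : θ ∈ s)
    (hx : ∀ᶠ t in 𝓝[s] θ, DifferentiableWithinAt ℝ x s t)
    (hv : TwiceDiffWithinAt (derivWithin x s) s θ) (ζ : E) :
    TwiceDiffWithinAt (fun t => (t, x t, derivWithin x s t + ζ)) s θ := by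
  refine twiceDiffWithinAt_of_hasDerivWithinAt hs hθ
    (g' := fun t => (1, derivWithin x s t, derivWithin (derivWithin x s) s t)) ?_ ?_
  · filter_upwards [hx, hv.hasDerivWithinAt] with t h1 h2
    exact (hasDerivWithinAt_id t s).prodMk (h1.hasDerivWithinAt.prodMk (h2.add_const ζ))
  · exact (differentiableWithinAt_const _).prodMk ((hv.differentiableWithinAt hθ).prodMk hv.2)

/-- `E(L̄)` contains `L_ẋ` itself, so its second time derivative needs `L_ẋ`, and not only `L`, to
be `C²`. -/
theorem twiceDiffWithinAt_EBar
    (hL : ContDiffOn ℝ 2 (fun p : ℝ × E × E => L p.1 p.2.1 p.2.2) (Ioo a b ×ˢ univ))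
    (hLv : ContDiffOn ℝ 2 (fun p : ℝ × E × E => Lv L p.1 p.2.1 p.2.2) (Ioo a b ×ˢ univ))
    (hs : UniqueDiffOn ℝ s) (hθ : θ ∈ s) (hθab : θ ∈ Ioo a b)
    (hx : ∀ᶠ t in 𝓝[s] θ, DifferentiableWithinAt ℝ x s t)
    (hv : TwiceDiffWithinAt (derivWithin x s) s θ) (ζ : E) :
    TwiceDiffWithinAt (fun t => EBar L x s t ζ) s θ := by
  have hU := isOpen_domain (E := E) a b
  have hγ := twiceDiffWithinAt_curve hs hθ hx hv
  have h1 := (hγ ζ).comp hU hL hs hθ ⟨hθab, trivial⟩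
  have h2 := (hγ 0).comp hU hL hs hθ ⟨hθab, trivial⟩
  have h3 := (hγ 0).comp hU (hLv.clm_apply (contDiffOn_const (c := ζ))) hs hθ ⟨hθab, trivial⟩
  simpa only [EBar, weierstrassFun, add_sub_cancel_left, add_zero] using
    (h1.sub hs hθ h2).sub hs hθ h3

/-- One time derivative is all that a `C¹` function `L_x` gives, and it suffices: this term carries
the factor `ω`, which is of order `ε`. -/
theorem differentiableWithinAt_DeltaLx
    (hL : ContDiffOn ℝ 2 (fun p : ℝ × E × E => L p.1 p.2.1 p.2.2) (Ioo a b ×ˢ univ))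
    (hs : UniqueDiffOn ℝ s) (hθ : θ ∈ s) (hθab : θ ∈ Ioo a b)
    (hx : ∀ᶠ t in 𝓝[s] θ, DifferentiableWithinAt ℝ x s t)
    (hv : TwiceDiffWithinAt (derivWithin x s) s θ) (ζ η : E) :
    DifferentiableWithinAt ℝ (fun t => DeltaLx L x s t ζ η) s θ := by
  have hγ := fun ζ => (twiceDiffWithinAt_curve hs hθ hx hv ζ).differentiableWithinAt hθ
  have hd : ∀ p ∈ Ioo a b ×ˢ (univ : Set (E × E)),
      DifferentiableAt ℝ (fun p : ℝ × E × E => Lx L p.1 p.2.1 p.2.2) p := fun p hp =>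
    ((contDiffOn_Lx hL).differentiableOn (by norm_num)).differentiableAt
      ((isOpen_domain a b).mem_nhds hp)
  have h1 := (hd (θ, x θ, derivWithin x s θ + ζ) ⟨hθab, trivial⟩).comp_differentiableWithinAt θ (hγ ζ)
  have h2 := (hd (θ, x θ, derivWithin x s θ + 0) ⟨hθab, trivial⟩).comp_differentiableWithinAt θ (hγ 0)
  have h3 := (h1.sub h2).clm_apply (differentiableWithinAt_const η)
  simpa only [Function.comp_def, DeltaLx, add_zero, Pi.sub_apply] using h3

/-- Changing the slope first and the position second isolates the Weierstrass function, the jump of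
`L_x`, and a Taylor remainder in `x` at the new slope. -/
theorem excess_eq (t ω : ℝ) (ζ : E) :
    excess L x (derivWithin x s) t ω ζ = EBar L x s t ζ + ω * DeltaLx L x s t ζ ζ
      + (L t (x t + ω • ζ) (derivWithin x s t + ζ) - L t (x t) (derivWithin x s t + ζ)
        - Lx L t (x t) (derivWithin x s t + ζ) ζ * ω) := by
  simp only [excess, EBar, weierstrassFun, DeltaLx, add_sub_cancel_left, map_smul, smul_eq_mul,
    _root_.sub_apply]
  ring

/-- Second order expansion of the nonlinear increment of the integrand. -/
theorem abs_excess_sub_le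
    (hL : ContDiffOn ℝ 2 (fun p : ℝ × E × E => L p.1 p.2.1 p.2.2) (Ioo a b ×ˢ univ))
    (hLv : ContDiffOn ℝ 2 (fun p : ℝ × E × E => Lv L p.1 p.2.1 p.2.2) (Ioo a b ×ˢ univ))
    (hsc : Convex ℝ s) (hs : UniqueDiffOn ℝ s) (hθ : θ ∈ s) (hθab : θ ∈ Ioo a b)
    (hx : ∀ᶠ t in 𝓝[s] θ, DifferentiableWithinAt ℝ x s t)
    (hv : TwiceDiffWithinAt (derivWithin x s) s θ) (ζ : E) {κ : ℝ} (hκ : 0 < κ) :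
    ∃ r > 0, ∀ t ∈ s, |t - θ| < r → ∀ ω, |ω| < r →
      |excess L x (derivWithin x s) t ω ζ - (EBar L x s θ ζ
        + derivWithin (fun t => EBar L x s t ζ) s θ * (t - θ)
        + derivWithin (derivWithin (fun t => EBar L x s t ζ) s) s θ / 2 * (t - θ) ^ 2
        + ω * (DeltaLx L x s θ ζ ζ + derivWithin (fun t => DeltaLx L x s t ζ ζ) s θ * (t - θ))
        + LxxBar L x s θ ζ ζ ζ / 2 * ω ^ 2)| ≤ κ * ((t - θ) ^ 2 + |ω| * |t - θ| + ω ^ 2) := by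
  obtain ⟨r₁, hr₁, H₁⟩ := (twiceDiffWithinAt_EBar hL hLv hs hθ hθab hx hv ζ).exists_bound hsc hθ hκ
  obtain ⟨r₂, hr₂, H₂⟩ := DifferentiableWithinAt.exists_bound
    (differentiableWithinAt_DeltaLx hL hs hθ hθab hx hv ζ ζ) hκ
  have hxc : ContinuousWithinAt x s θ := (hx.self_of_nhdsWithin hθ).continuousWithinAt
  have hvc : ContinuousWithinAt (derivWithin x s) s θ :=
    (hv.differentiableWithinAt hθ).continuousWithinAt
  -- Joint continuity of `L_xx` makes the Taylor remainder in `x` uniform in `t`.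
  have hB : ∃ r > 0, ∀ t ∈ s, |t - θ| < r → ∀ τ, |τ| < r →
      |Lxx L t (x t + τ • ζ) (derivWithin x s t + ζ) ζ ζ - LxxBar L x s θ ζ ζ ζ| ≤ κ := by
    have hfst : Tendsto Prod.fst (𝓝[s] θ ×ˢ 𝓝 (0 : ℝ)) (𝓝[s] θ) := tendsto_fst
    have hsnd : Tendsto Prod.snd (𝓝[s] θ ×ˢ 𝓝 (0 : ℝ)) (𝓝 0) := tendsto_snd
    have h1 : Tendsto (fun z : ℝ × ℝ => (z.1, x z.1 + z.2 • ζ, derivWithin x s z.1 + ζ))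
        (𝓝[s] θ ×ˢ 𝓝 (0 : ℝ)) (𝓝 (θ, x θ + (0 : ℝ) • ζ, derivWithin x s θ + ζ)) :=
      (hfst.mono_right nhdsWithin_le_nhds).prodMk_nhds
        (((hxc.tendsto.comp hfst).add (hsnd.smul_const ζ)).prodMk_nhds
          ((hvc.tendsto.comp hfst).add_const ζ))
    rw [zero_smul, add_zero] at h1
    have h2 := (((continuousOn_Lxx hL).clm_apply (continuousOn_const (c := ζ))).clm_apply
      (continuousOn_const (c := ζ))).continuousAt ((isOpen_domain a b).mem_nhds
        (show (θ, x θ, derivWithin x s θ + ζ) ∈ Ioo a b ×ˢ univ from ⟨hθab, trivial⟩))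
    have h3 := Metric.tendsto_nhds.1 (h2.tendsto.comp h1) κ hκ
    obtain ⟨p, hp, q, hq, hpq⟩ := eventually_prod_iff.1 h3
    obtain ⟨r, hr, hr'⟩ := Metric.mem_nhdsWithin_iff.1 hp
    obtain ⟨r', hr0, hr0'⟩ := Metric.mem_nhds_iff.1 hq
    refine ⟨min r r', lt_min hr hr0, fun t ht htr τ hτ => ?_⟩
    have h4 := hpq (hr' ⟨by simpa [Real.dist_eq] using htr.trans_le (min_le_left _ _), ht⟩)
      (hr0' (by simpa using hτ.trans_le (min_le_right _ _) : τ ∈ Metric.ball 0 r'))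
    exact (le_of_lt (by simpa [Real.dist_eq, LxxBar] using h4))
  obtain ⟨r₃, hr₃, H₃⟩ := hB
  obtain ⟨r₄, hr₄, H₄⟩ := Metric.isOpen_iff.1 (isOpen_Ioo (a := a) (b := b)) θ hθab
  refine ⟨min (min r₁ r₂) (min r₃ r₄), by positivity, fun t ht htr ω hω => ?_⟩
  simp only [lt_min_iff] at htr hω
  have htab : t ∈ Ioo a b := H₄ (by simpa [Real.dist_eq] using htr.2.2)
  have k1 := H₁ t ht htr.1.1
  have k2 := H₂ t ht htr.1.2
  have hline : ∀ τ : ℝ, HasDerivAt (fun τ : ℝ => x t + τ • ζ) ζ τ := fun τ => by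
    simpa using ((hasDerivAt_id τ).smul_const ζ).const_add (x t)
  have k3 := abs_sub_taylor_le (κ := κ) (B := LxxBar L x s θ ζ ζ ζ) (ω := ω)
    (g := fun τ => L t (x t + τ • ζ) (derivWithin x s t + ζ))
    (g' := fun τ => Lx L t (x t + τ • ζ) (derivWithin x s t + ζ) ζ)
    (g'' := fun τ => Lxx L t (x t + τ • ζ) (derivWithin x s t + ζ) ζ ζ)
    (fun τ => (hasFDerivAt_Lx hL htab _ _).comp_hasDerivAt τ (hline τ))
    (fun τ => by
      simpa using ((hasFDerivAt_Lxx hL htab _ _).comp_hasDerivAt τ (hline τ)).clm_apply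
        (hasDerivAt_const τ ζ))
    (fun τ hτ => H₃ t ht htr.2.1 τ (hτ.trans_lt hω.2.1))
  simp only [zero_smul, add_zero] at k3
  rw [Real.norm_eq_abs, smul_eq_mul] at k2
  have k2' : |ω * (DeltaLx L x s t ζ ζ - DeltaLx L x s θ ζ ζ
      - (t - θ) * derivWithin (fun t => DeltaLx L x s t ζ ζ) s θ)| ≤ κ * (|ω| * |t - θ|) := by
    rw [abs_mul]
    calc _ ≤ |ω| * (κ * |t - θ|) := by gcongr
      _ = _ := by ring
  rw [excess_eq]
  rw [abs_le] at k1 k2' k3 ⊢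
  constructor <;> linarith [k1.1, k1.2, k2'.1, k2'.2, k3.1, k3.2]

/-- The change of the functional under the tent variation on the interval between `θ` and `θ + ε`
(where `ε` may be negative), without its linear part. -/
noncomputable def tentExcess (L : ℝ → E → E → ℝ) (x v : ℝ → E) (θ l : ℝ) (ξ : E) (ε : ℝ) : ℝ :=
  (∫ t in θ..(θ + l * ε), excess L x v t (t - θ) ξ)
    + ∫ t in (θ + l * ε)..(θ + ε), excess L x v t (t - (θ + ε)) ((l / (l - 1)) • ξ)

/-- Convexity of `s` puts the whole interval between `θ` and `θ + ε` inside `s`; at its interior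
points the derivative within `s` is an ordinary derivative, as the tent comparison requires. -/
theorem exists_continuousOn
    (hθ : θ ∈ s) (hsc : Convex ℝ s) (hθab : θ ∈ Ioo a b)
    (hx : ∀ᶠ t in 𝓝[s] θ, DifferentiableWithinAt ℝ x s t)
    (hv : TwiceDiffWithinAt (derivWithin x s) s θ) :
    ∃ r > 0, ∀ ε, |ε| < r → θ + ε ∈ s →
      uIcc θ (θ + ε) ⊆ s ∧ uIcc θ (θ + ε) ⊆ Ioo a b ∧ DifferentiableOn ℝ x (uIcc θ (θ + ε)) ∧
      ContinuousOn (derivWithin x s) (uIcc θ (θ + ε)) ∧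
      ∀ t ∈ uIoo θ (θ + ε), HasDerivAt x (derivWithin x s t) t := by
  obtain ⟨r₁, hr₁, H₁⟩ := Metric.mem_nhdsWithin_iff.1 (hx.and hv.1)
  obtain ⟨r₂, hr₂, H₂⟩ := Metric.isOpen_iff.1 (isOpen_Ioo (a := a) (b := b)) θ hθab
  refine ⟨min r₁ r₂, lt_min hr₁ hr₂, fun ε hε hεs => ?_⟩
  rw [lt_min_iff] at hε
  have hs' : uIcc θ (θ + ε) ⊆ s := by
    rw [← segment_eq_uIcc]; exact hsc.segment_subset hθ hεs
  have hball : ∀ r, |ε| < r → uIcc θ (θ + ε) ⊆ Metric.ball θ r := fun r hr t ht => by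
    have := abs_sub_left_of_mem_uIcc ht
    rw [add_sub_cancel_left] at this
    simpa [Real.dist_eq] using this.trans_lt hr
  have hd : ∀ t ∈ uIcc θ (θ + ε), DifferentiableWithinAt ℝ x s t ∧
      DifferentiableWithinAt ℝ (derivWithin x s) s t := fun t ht =>
    H₁ ⟨hball r₁ hε.1 ht, hs' ht⟩
  refine ⟨hs', (hball r₂ hε.2).trans H₂, fun t ht => (hd t ht).1.mono hs',
    fun t ht => ((hd t ht).2.mono hs').continuousWithinAt, fun t ht => ?_⟩
  exact (hd t (Ioo_subset_Icc_self ht)).1.hasDerivWithinAt.hasDerivAt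
    (mem_of_superset (Ioo_mem_nhds ht.1 ht.2) (Ioo_subset_Icc_self.trans hs'))

/-- Third order expansion of the functional under a tent variation. -/
theorem abs_tentExcess_sub_le
    (hL : ContDiffOn ℝ 2 (fun p : ℝ × E × E => L p.1 p.2.1 p.2.2) (Ioo a b ×ˢ univ))
    (hLv : ContDiffOn ℝ 2 (fun p : ℝ × E × E => Lv L p.1 p.2.1 p.2.2) (Ioo a b ×ˢ univ))
    (hsc : Convex ℝ s) (hs : UniqueDiffOn ℝ s) (hθ : θ ∈ s) (hθab : θ ∈ Ioo a b)
    (hx : ∀ᶠ t in 𝓝[s] θ, DifferentiableWithinAt ℝ x s t)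
    (hv : TwiceDiffWithinAt (derivWithin x s) s θ) {l : ℝ} (hl : l ∈ Ioo (0 : ℝ) 1) {ξ : E}
    (h1 : EBar L x s θ ξ = 0) (h2 : EBar L x s θ ((l / (l - 1)) • ξ) = 0)
    {κ : ℝ} (hκ : 0 < κ) :
    ∃ r > 0, ∀ ε, |ε| < r → θ + ε ∈ s →
      |tentExcess L x (derivWithin x s) θ l ξ ε
        - (ε ^ 2 / 2 * W L x s θ l ξ + ε ^ 3 / 6 * G L x s θ l ξ)| ≤ κ * |ε| ^ 3 := by
  obtain ⟨hl0, hl1⟩ := hl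
  set c : ℝ := l / (l - 1) with hc
  -- The error has three terms, each at most `ε²`.
  have hκ3 : 0 < κ / 3 := by positivity
  obtain ⟨r₁, hr₁, H₁⟩ := abs_excess_sub_le hL hLv hsc hs hθ hθab hx hv ξ hκ3
  obtain ⟨r₂, hr₂, H₂⟩ := abs_excess_sub_le hL hLv hsc hs hθ hθab hx hv (c • ξ) hκ3
  obtain ⟨r₃, hr₃, H₃⟩ := exists_continuousOn hθ hsc hθab hx hv
  refine ⟨min r₁ (min r₂ r₃), by positivity, fun ε hε hεs => ?_⟩
  simp only [lt_min_iff] at hε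
  obtain ⟨hsub, hab, hxd, hvc, -⟩ := H₃ ε hε.2.2 hεs
  have hm : θ + l * ε ∈ uIcc θ (θ + ε) := by
    rcases le_total 0 ε with h | h
    · rw [uIcc_of_le (by linarith)]; constructor <;> nlinarith
    · rw [uIcc_of_ge (by linarith)]; constructor <;> nlinarith
  have s1 : uIcc θ (θ + l * ε) ⊆ uIcc θ (θ + ε) := uIcc_subset_uIcc left_mem_uIcc hm
  have s2 : uIcc (θ + l * ε) (θ + ε) ⊆ uIcc θ (θ + ε) := uIcc_subset_uIcc hm right_mem_uIcc
  have hdist : ∀ t ∈ uIcc θ (θ + ε), |t - θ| ≤ |ε| ∧ |t - (θ + ε)| ≤ |ε| := fun t ht => by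
    have h3 := abs_sub_left_of_mem_uIcc ht
    have h4 := abs_sub_right_of_mem_uIcc ht
    rw [add_sub_cancel_left] at h3 h4
    exact ⟨h3, by rwa [abs_sub_comm]⟩
  have herr : ∀ u w : ℝ, |u| ≤ |ε| → |w| ≤ |ε| →
      κ / 3 * (u ^ 2 + |w| * |u| + w ^ 2) ≤ κ * ε ^ 2 := fun u w hu hw => by
    have a1 : u ^ 2 ≤ ε ^ 2 := sq_le_sq.2 hu
    have a2 : w ^ 2 ≤ ε ^ 2 := sq_le_sq.2 hw
    have a3 : |w| * |u| ≤ ε ^ 2 := by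
      rw [← sq_abs ε, sq]; exact mul_le_mul hw hu (abs_nonneg _) (abs_nonneg _)
    nlinarith
  have I1 := abs_integral_sub_quadratic_le (θ := θ) (p := θ) (q := θ + l * ε) (κ := κ * ε ^ 2)
    (f := fun t => excess L x (derivWithin x s) t (t - θ) ξ) (A := 0)
    (B := derivWithin (fun t => EBar L x s t ξ) s θ + DeltaLx L x s θ ξ ξ)
    (C := derivWithin (derivWithin (fun t => EBar L x s t ξ) s) s θ / 2
      + derivWithin (fun t => DeltaLx L x s t ξ ξ) s θ + LxxBar L x s θ ξ ξ ξ / 2)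
    ((continuousOn_excess hL hab hxd.continuousOn hvc θ ξ).mono s1).intervalIntegrable
    (fun t ht => by
      have ht' := s1 (uIoc_subset_uIcc ht)
      have hd := (hdist t ht').1
      refine le_trans (le_of_eq ?_) ((H₁ t (hsub ht') (hd.trans_lt hε.1) (t - θ)
        (hd.trans_lt hε.1)).trans (herr _ _ hd hd))
      rw [h1]
      congr 1
      ring)
  -- Here `ω = (t - θ) - ε`. Rearranging in powers of `t - θ` puts `ε` into the coefficients.
  have I2 := abs_integral_sub_quadratic_le (θ := θ) (p := θ + l * ε) (q := θ + ε) (κ := κ * ε ^ 2)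
    (f := fun t => excess L x (derivWithin x s) t (t - (θ + ε)) (c • ξ))
    (A := -ε * DeltaLx L x s θ (c • ξ) (c • ξ)
      + ε ^ 2 * LxxBar L x s θ (c • ξ) (c • ξ) (c • ξ) / 2)
    (B := derivWithin (fun t => EBar L x s t (c • ξ)) s θ + DeltaLx L x s θ (c • ξ) (c • ξ)
      - ε * derivWithin (fun t => DeltaLx L x s t (c • ξ) (c • ξ)) s θ
      - ε * LxxBar L x s θ (c • ξ) (c • ξ) (c • ξ))
    (C := derivWithin (derivWithin (fun t => EBar L x s t (c • ξ)) s) s θ / 2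
      + derivWithin (fun t => DeltaLx L x s t (c • ξ) (c • ξ)) s θ
      + LxxBar L x s θ (c • ξ) (c • ξ) (c • ξ) / 2)
    ((continuousOn_excess hL hab hxd.continuousOn hvc (θ + ε) (c • ξ)).mono s2).intervalIntegrable
    (fun t ht => by
      have ht' := s2 (uIoc_subset_uIcc ht)
      have hd := (hdist t ht').1
      have hd' := (hdist t ht').2
      refine le_trans (le_of_eq ?_) ((H₂ t (hsub ht') (hd.trans_lt hε.2.1) (t - (θ + ε))
        (hd'.trans_lt hε.2.1)).trans (herr _ _ hd hd'))
      rw [h2]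
      congr 1
      ring)
  have hE1 := twiceDiffWithinAt_EBar hL hLv hs hθ hθab hx hv ξ
  have hE2 := twiceDiffWithinAt_EBar hL hLv hs hθ hθab hx hv (c • ξ)
  have hD1 := differentiableWithinAt_DeltaLx hL hs hθ hθab hx hv ξ ξ
  have hD2 := differentiableWithinAt_DeltaLx hL hs hθ hθab hx hv (c • ξ) ξ
  have hD2' : derivWithin (fun t => DeltaLx L x s t (c • ξ) (c • ξ)) s θ
      = c * derivWithin (fun t => DeltaLx L x s t (c • ξ) ξ) s θ := by
    simp only [map_smul, smul_eq_mul]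
    exact (hD2.hasDerivWithinAt.const_mul c).derivWithin (hs θ hθ)
  have hM : derivWithin (fun t => M 2 L x s t l ξ) s θ
      = l ^ 2 * derivWithin (fun t => DeltaLx L x s t ξ ξ) s θ
        + (1 - l) * (1 / 2 + l) * derivWithin (fun t => DeltaLx L x s t (c • ξ) ξ) s θ := by
    simp only [M, ← hc, Nat.add_one_sub_one, pow_one]
    exact ((hD1.hasDerivWithinAt.const_mul _).add
      (hD2.hasDerivWithinAt.const_mul _)).derivWithin (hs θ hθ)
  have hQ2 := (hE1.linear_combination hs hθ hE2 (l ^ 2) (1 - l ^ 2)).1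
  have hQ3 := (hE1.linear_combination hs hθ hE2 (l ^ 3) (1 - l ^ 3)).2
  have hbound : κ * ε ^ 2 * |θ + l * ε - θ| + κ * ε ^ 2 * |θ + ε - (θ + l * ε)| = κ * |ε| ^ 3 := by
    have e1 : θ + l * ε - θ = l * ε := by ring
    have e2 : θ + ε - (θ + l * ε) = (1 - l) * ε := by ring
    rw [e1, e2, abs_mul, abs_mul, abs_of_pos hl0, abs_of_pos (by linarith : 0 < 1 - l), ← sq_abs ε]
    ring
  rw [← hbound]
  refine le_trans (le_of_eq ?_) ((abs_add_le _ _).trans (add_le_add I1 I2))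
  congr 1
  -- It remains to match coefficients, using `c = l / (l - 1)`. The factor `1 / 2 + l` in `M 2`
  -- arises from `∫ (τ - ε) τ dτ` over `[lε, ε]`, which is `-(ε³ / 6) (1 - l)² (1 + 2l)`.
  simp only [hD2']
  simp only [tentExcess, W, G, Q, M, ← hc, hQ2, hQ3] at hM ⊢
  rw [hM]
  simp only [map_smul, smul_eq_mul, _root_.smul_apply]
  have hl' : l - 1 ≠ 0 := by linarith
  rw [hc]
  field_simp
  ring

end Expansion

/-! ### Sign conditions on either side of `θ`, and the theorem -/

section Necessary

variable {E : Type*} [NormedAddCommGroup E] [NormedSpace ℝ E] {a b t₀ t₁ : ℝ}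
  {L : ℝ → E → E → ℝ} {x : ℝ → E} {s : Set ℝ} {θ : ℝ}

/-- Derivatives within a set are local. This passes from the half-open interval of the hypothesis to
the half-line within which the time derivatives are taken. -/
theorem ThriceDifferentiableOn.of_inter {V : Set ℝ} (hV : IsOpen V) (hθ : θ ∈ V)
    (hθs : θ ∈ s) (h : ThriceDifferentiableOn x (s ∩ V)) :
    (∀ᶠ t in 𝓝[s] θ, DifferentiableWithinAt ℝ x s t) ∧
      TwiceDiffWithinAt (derivWithin x s) s θ := by
  have hmem : ∀ t ∈ s ∩ V, s ∩ V ∈ 𝓝[s] t := fun t ht =>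
    inter_mem self_mem_nhdsWithin (mem_nhdsWithin_of_mem_nhds (hV.mem_nhds ht.2))
  have hd : ∀ f : ℝ → E, ∀ t ∈ s ∩ V, derivWithin f (s ∩ V) t = derivWithin f s t :=
    fun f t ht => derivWithin_inter (hV.mem_nhds ht.2)
  have hdd : ∀ t ∈ s ∩ V, derivWithin (derivWithin x (s ∩ V)) (s ∩ V) t
      = derivWithin (derivWithin x s) s t := fun t ht => by
    rw [derivWithin_congr (hd x) (hd x t ht), hd _ t ht]
  have hsV := hmem θ ⟨hθs, hθ⟩
  refine ⟨?_, ?_, ?_⟩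
  · filter_upwards [hsV] with t ht
    exact (h.1 t ht).mono_of_mem_nhdsWithin (hmem t ht)
  · filter_upwards [hsV] with t ht
    exact ((h.2.1 t ht).congr (fun u hu => (hd x u hu).symm)
      (hd x t ht).symm).mono_of_mem_nhdsWithin (hmem t ht)
  · exact ((h.2.2 θ ⟨hθs, hθ⟩).congr (fun u hu => (hdd u hu).symm)
      (hdd θ ⟨hθs, hθ⟩).symm).mono_of_mem_nhdsWithin hsV

theorem ThriceDifferentiableAt.twiceDiffWithinAt (h : ThriceDifferentiableAt x θ) :
    (∀ᶠ t in 𝓝[univ] θ, DifferentiableWithinAt ℝ x univ t) ∧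
      TwiceDiffWithinAt (derivWithin x univ) univ θ := by
  simpa only [TwiceDiffWithinAt, nhdsWithin_univ, differentiableWithinAt_univ, derivWithin_univ,
    ThriceDifferentiableAt] using h

/-- Tent variations on small intervals to the right of `θ` do not decrease the functional. -/
theorem exists_tentExcess_nonneg (hI : Icc t₀ t₁ ⊆ Ioo a b)
    (hL : ContDiffOn ℝ 2 (fun p : ℝ × E × E => L p.1 p.2.1 p.2.2) (Ioo a b ×ˢ univ))
    {x₀ x₁ : E} (hmin : IsStrongLocalMin t₀ t₁ x₀ x₁ L x) (hsc : Convex ℝ s) (hθ : θ ∈ s)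
    (hx : ∀ᶠ t in 𝓝[s] θ, DifferentiableWithinAt ℝ x s t)
    (hv : TwiceDiffWithinAt (derivWithin x s) s θ) {l : ℝ} (hl : l ∈ Ioo (0 : ℝ) 1) (ξ : E)
    (hθt : θ ∈ Ico t₀ t₁) (hsub : Ici θ ⊆ s) :
    ∃ r > 0, ∀ ε, 0 < ε → ε < r → 0 ≤ tentExcess L x (derivWithin x s) θ l ξ ε := by
  obtain ⟨hadm, δ, hδ0, hδ⟩ := hmin
  obtain ⟨hl0, hl1⟩ := hl
  set ζ : E := (l / (l - 1)) • ξ with hζ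
  obtain ⟨r₁, hr₁, H₁⟩ := exists_continuousOn hθ hsc (hI (Ico_subset_Icc_self hθt)) hx hv
  have hpos : 0 < ‖ξ‖ + ‖ζ‖ + 1 := by positivity
  -- The bounds give, in turn, smoothness of `x`, a tent inside the interval, and a tent of height
  -- at most `δ`; the `1` keeps the denominator positive.
  refine ⟨min r₁ (min (t₁ - θ) (δ / (‖ξ‖ + ‖ζ‖ + 1))),
    lt_min hr₁ (lt_min (by linarith [hθt.2]) (by positivity)), fun ε hε hεr => ?_⟩
  simp only [lt_min_iff] at hεr
  obtain ⟨-, -, -, hvc, hder⟩ := H₁ ε (by rw [abs_of_pos hε]; exact hεr.1)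
    (hsub (by simp [hε.le]))
  rw [uIcc_of_le (by linarith)] at hvc
  rw [uIoo_of_le (by linarith)] at hder
  have hlε : 0 < l * ε := mul_pos hl0 hε
  have hlε' : l * ε < ε := by nlinarith
  refine integral_excess_nonneg hI hL hadm hδ hθt.1 (by linarith) (by linarith)
    (by linarith [hεr.2.1]) hvc hder ?_ ?_
  · have hl' : l - 1 ≠ 0 := by linarith
    rw [smul_smul, ← add_smul]
    convert zero_smul ℝ ξ using 2
    field_simp
    ring
  · have h1 : ε * (‖ξ‖ + ‖ζ‖ + 1) < δ := (lt_div_iff₀ hpos).1 hεr.2.2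
    have h2 : l * ε * ‖ξ‖ ≤ ε * ‖ξ‖ := by gcongr
    have h3 : (ε - l * ε) * ‖ζ‖ ≤ ε * ‖ζ‖ := by gcongr; linarith
    rw [add_sub_cancel_left, add_sub_add_left_eq_sub]
    nlinarith

/-- Tent variations on small intervals to the left of `θ` do not decrease the functional; the sign
comes from the orientation of the integrals. -/
theorem exists_tentExcess_neg_nonpos (hI : Icc t₀ t₁ ⊆ Ioo a b)
    (hL : ContDiffOn ℝ 2 (fun p : ℝ × E × E => L p.1 p.2.1 p.2.2) (Ioo a b ×ˢ univ))
    {x₀ x₁ : E} (hmin : IsStrongLocalMin t₀ t₁ x₀ x₁ L x) (hsc : Convex ℝ s) (hθ : θ ∈ s)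
    (hx : ∀ᶠ t in 𝓝[s] θ, DifferentiableWithinAt ℝ x s t)
    (hv : TwiceDiffWithinAt (derivWithin x s) s θ) {l : ℝ} (hl : l ∈ Ioo (0 : ℝ) 1) (ξ : E)
    (hθt : θ ∈ Ioc t₀ t₁) (hsub : Iic θ ⊆ s) :
    ∃ r > 0, ∀ ε, 0 < ε → ε < r → 0 ≤ -tentExcess L x (derivWithin x s) θ l ξ (-ε) := by
  obtain ⟨hadm, δ, hδ0, hδ⟩ := hmin
  obtain ⟨hl0, hl1⟩ := hl
  set ζ : E := (l / (l - 1)) • ξ with hζ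
  obtain ⟨r₁, hr₁, H₁⟩ := exists_continuousOn hθ hsc (hI (Ioc_subset_Icc_self hθt)) hx hv
  have hpos : 0 < ‖ξ‖ + ‖ζ‖ + 1 := by positivity
  refine ⟨min r₁ (min (θ - t₀) (δ / (‖ξ‖ + ‖ζ‖ + 1))),
    lt_min hr₁ (lt_min (by linarith [hθt.1]) (by positivity)), fun ε hε hεr => ?_⟩
  simp only [lt_min_iff] at hεr
  obtain ⟨-, -, -, hvc, hder⟩ := H₁ (-ε) (by rw [abs_neg, abs_of_pos hε]; exact hεr.1)
    (hsub (by simp [hε.le]))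
  rw [uIcc_of_ge (by linarith)] at hvc
  rw [uIoo_of_ge (by linarith)] at hder
  have hlε : 0 < l * ε := mul_pos hl0 hε
  have hlε' : l * ε < ε := by nlinarith
  -- In increasing time the pieces appear in reverse order: slope `ζ` comes first, and `ξ` is next
  -- to `θ`.
  have key := integral_excess_nonneg hI hL hadm hδ (p := θ + -ε) (m := θ + l * -ε) (q := θ)
    (u := ζ) (w := ξ) (by linarith [hεr.2.1]) (by linarith) (by linarith) hθt.2 hvc hder ?_ ?_
  · rw [tentExcess, intervalIntegral.integral_symm, ← hζ,
      intervalIntegral.integral_symm (θ + -ε)]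
    linarith
  · have hl' : l - 1 ≠ 0 := by linarith
    rw [smul_smul, ← add_smul]
    convert zero_smul ℝ ξ using 2
    field_simp
    ring
  · have h1 : ε * (‖ξ‖ + ‖ζ‖ + 1) < δ := (lt_div_iff₀ hpos).1 hεr.2.2
    have h2 : l * ε * ‖ξ‖ ≤ ε * ‖ξ‖ := by gcongr
    have h3 : (ε - l * ε) * ‖ζ‖ ≤ ε * ‖ζ‖ := by gcongr; linarith
    rw [show θ + l * -ε - (θ + -ε) = ε - l * ε by ring, show θ - (θ + l * -ε) = l * ε by ring]
    nlinarith

/-- The necessary condition for variations on the right of `θ`. -/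
theorem IsStrongLocalMin.nonneg_right (hI : Icc t₀ t₁ ⊆ Ioo a b)
    (hL : ContDiffOn ℝ 2 (fun p : ℝ × E × E => L p.1 p.2.1 p.2.2) (Ioo a b ×ˢ univ))
    (hLv : ContDiffOn ℝ 2 (fun p : ℝ × E × E => Lv L p.1 p.2.1 p.2.2) (Ioo a b ×ˢ univ))
    {x₀ x₁ : E} (hmin : IsStrongLocalMin t₀ t₁ x₀ x₁ L x) (hsc : Convex ℝ s)
    (hs : UniqueDiffOn ℝ s) (hx : ∀ᶠ t in 𝓝[s] θ, DifferentiableWithinAt ℝ x s t)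
    (hv : TwiceDiffWithinAt (derivWithin x s) s θ) {l : ℝ} (hl : l ∈ Ioo (0 : ℝ) 1) {ξ : E}
    (hθt : θ ∈ Ico t₀ t₁) (hsub : Ici θ ⊆ s)
    (h1 : EBar L x s θ ξ = 0) (h2 : EBar L x s θ ((l / (l - 1)) • ξ) = 0) :
    0 ≤ W L x s θ l ξ ∧ (W L x s θ l ξ = 0 → 0 ≤ G L x s θ l ξ) := by
  have hθ : θ ∈ s := hsub self_mem_Ici
  refine nonneg_coeff_of_expansion (F := tentExcess L x (derivWithin x s) θ l ξ) ?_
    (exists_tentExcess_nonneg hI hL hmin hsc hθ hx hv hl ξ hθt hsub)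
  intro κ hκ
  obtain ⟨r, hr, H⟩ := abs_tentExcess_sub_le hL hLv hsc hs hθ
    (hI (Ico_subset_Icc_self hθt)) hx hv hl h1 h2 hκ
  refine ⟨r, hr, fun ε hε hεr => ?_⟩
  simpa only [abs_of_pos hε] using
    H ε (by rwa [abs_of_pos hε]) (hsub (by simp [hε.le]))

/-- The necessary condition for variations on the left of `θ`. -/
theorem IsStrongLocalMin.nonneg_left (hI : Icc t₀ t₁ ⊆ Ioo a b)
    (hL : ContDiffOn ℝ 2 (fun p : ℝ × E × E => L p.1 p.2.1 p.2.2) (Ioo a b ×ˢ univ))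
    (hLv : ContDiffOn ℝ 2 (fun p : ℝ × E × E => Lv L p.1 p.2.1 p.2.2) (Ioo a b ×ˢ univ))
    {x₀ x₁ : E} (hmin : IsStrongLocalMin t₀ t₁ x₀ x₁ L x) (hsc : Convex ℝ s)
    (hs : UniqueDiffOn ℝ s) (hx : ∀ᶠ t in 𝓝[s] θ, DifferentiableWithinAt ℝ x s t)
    (hv : TwiceDiffWithinAt (derivWithin x s) s θ) {l : ℝ} (hl : l ∈ Ioo (0 : ℝ) 1) {ξ : E}
    (hθt : θ ∈ Ioc t₀ t₁) (hsub : Iic θ ⊆ s)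
    (h1 : EBar L x s θ ξ = 0) (h2 : EBar L x s θ ((l / (l - 1)) • ξ) = 0) :
    W L x s θ l ξ ≤ 0 ∧ (W L x s θ l ξ = 0 → 0 ≤ G L x s θ l ξ) := by
  have hθ : θ ∈ s := hsub self_mem_Iic
  have key := nonneg_coeff_of_expansion (w := -W L x s θ l ξ) (g := G L x s θ l ξ)
    (F := fun ε => -tentExcess L x (derivWithin x s) θ l ξ (-ε)) ?_
    (exists_tentExcess_neg_nonpos hI hL hmin hsc hθ hx hv hl ξ hθt hsub)
  · simpa only [neg_nonneg, neg_eq_zero] using key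
  intro κ hκ
  obtain ⟨r, hr, H⟩ := abs_tentExcess_sub_le hL hLv hsc hs hθ
    (hI (Ioc_subset_Icc_self hθt)) hx hv hl h1 h2 hκ
  refine ⟨r, hr, fun ε hε hεr => ?_⟩
  have := H (-ε) (by rwa [abs_neg, abs_of_pos hε]) (hsub (by simp [hε.le]))
  -- Under `ε ↦ -ε` and a change of overall sign the quadratic term flips and the cubic one does
  -- not.
  rw [abs_neg, abs_of_pos hε, ← abs_neg] at this
  convert this using 2
  ring

end Necessary

end CalcVar

theorem theorem3p2 {n : ℕ} (a b t₀ t₁ : ℝ) (ha : a < t₀) (ht : t₀ < t₁) (hb : t₁ < b)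
    (x₀ x₁ : EuclideanSpace ℝ (Fin n))
    (L : ℝ → EuclideanSpace ℝ (Fin n) → EuclideanSpace ℝ (Fin n) → ℝ)
    (hL : ContDiffOn ℝ 2
      (fun p : ℝ × EuclideanSpace ℝ (Fin n) × EuclideanSpace ℝ (Fin n) => L p.1 p.2.1 p.2.2)
      (Ioo a b ×ˢ univ))
    (hLv : ContDiffOn ℝ 2
      (fun p : ℝ × EuclideanSpace ℝ (Fin n) × EuclideanSpace ℝ (Fin n) =>
        CalcVar.Lv L p.1 p.2.1 p.2.2)
      (Ioo a b ×ˢ univ))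
    (xbar : ℝ → EuclideanSpace ℝ (Fin n))
    (hmin : CalcVar.IsStrongLocalMin t₀ t₁ x₀ x₁ L xbar) :
    -- (i), on the right of `θ`
    (∀ θ ∈ Ico t₀ t₁, ∀ α > 0, Ico θ (θ + α) ⊆ Icc t₀ t₁ →
      CalcVar.ThriceDifferentiableOn xbar (Ico θ (θ + α)) →
      ∀ l ∈ Ioo (0 : ℝ) 1, ∀ η : EuclideanSpace ℝ (Fin n), η ≠ 0 →
        CalcVar.EBar L xbar (Ici θ) θ η = 0 →
        CalcVar.EBar L xbar (Ici θ) θ ((l / (l - 1)) • η) = 0 →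
        CalcVar.W L xbar (Ici θ) θ l η = 0 →
        0 ≤ CalcVar.G L xbar (Ici θ) θ l η) ∧
    -- (i), on the left of `θ`
    (∀ θ ∈ Ioc t₀ t₁, ∀ α > 0, Ioc (θ - α) θ ⊆ Icc t₀ t₁ →
      CalcVar.ThriceDifferentiableOn xbar (Ioc (θ - α) θ) →
      ∀ l ∈ Ioo (0 : ℝ) 1, ∀ η : EuclideanSpace ℝ (Fin n), η ≠ 0 →
        CalcVar.EBar L xbar (Iic θ) θ η = 0 →
        CalcVar.EBar L xbar (Iic θ) θ ((l / (l - 1)) • η) = 0 →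
        CalcVar.W L xbar (Iic θ) θ l η = 0 →
        0 ≤ CalcVar.G L xbar (Iic θ) θ l η) ∧
    -- (ii), at an interior point `θ`
    (∀ θ ∈ Ioo t₀ t₁, CalcVar.ThriceDifferentiableAt xbar θ →
      ∀ l ∈ Ioo (0 : ℝ) 1, ∀ η : EuclideanSpace ℝ (Fin n), η ≠ 0 →
        CalcVar.EBar L xbar univ θ η = 0 →
        CalcVar.EBar L xbar univ θ ((l / (l - 1)) • η) = 0 →
        0 ≤ CalcVar.G L xbar univ θ l η) := by
  have hI : Icc t₀ t₁ ⊆ Ioo a b := fun t h => ⟨ha.trans_le h.1, h.2.trans_lt hb⟩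
  refine ⟨fun θ hθ α hα _ hd l hl η _ h1 h2 hW => ?_, fun θ hθ α hα _ hd l hl η _ h1 h2 hW => ?_,
    fun θ hθ hd l hl η _ h1 h2 => ?_⟩
  · rw [← Ici_inter_Iio] at hd
    obtain ⟨hx, hv⟩ := hd.of_inter isOpen_Iio (by simpa using hα) self_mem_Ici
    exact (hmin.nonneg_right hI hL hLv (convex_Ici θ) (uniqueDiffOn_Ici θ) hx hv hl hθ
      Subset.rfl h1 h2).2 hW
  · rw [← Ioi_inter_Iic, inter_comm] at hd
    obtain ⟨hx, hv⟩ := hd.of_inter isOpen_Ioi (by simpa using hα) self_mem_Iic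
    exact (hmin.nonneg_left hI hL hLv (convex_Iic θ) (uniqueDiffOn_Iic θ) hx hv hl hθ
      Subset.rfl h1 h2).2 hW
  · obtain ⟨hx, hv⟩ := hd.twiceDiffWithinAt
    have hr := hmin.nonneg_right hI hL hLv convex_univ uniqueDiffOn_univ hx hv hl
      (Ioo_subset_Ico_self hθ) (subset_univ _) h1 h2
    have hl' := hmin.nonneg_left hI hL hLv convex_univ uniqueDiffOn_univ hx hv hl
      (Ioo_subset_Ioc_self hθ) (subset_univ _) h1 h2
    -- With `s = univ` both sides speak of the same `W`, so the two inequalities give `W = 0`.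
    exact hr.2 (le_antisymm hl'.1 hr.1)
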